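/- Let $X\subset\mathbb R^m$ be a bounded, Lebesgue measurable set and let $p\in[1,\infty]$ with Hölder conjugate $p^*$. We equip $X$ with the Lebesgue $\sigma$-algebra and Lebesgue measure and $\mathbb R$ with the Borel $\sigma$-algebra; functions on products are called measurable if they are measurable for the corresponding product $\sigma$-algebra. For $q\in[0,\infty]$ and $M\in(0,\infty)$ let $\mathrm p^q_M(w)=|w|^q$ if $q<\infty$ (with $0^0=1$), and let $\mathrm p^\infty_M(w)=0$ if $|w|\le M$ and $\mathrm p^\infty_M(w)=\infty$ if $|w|>M$. We write $f_{(x,y)}(w,z)=f(x,y,w,z)$. A function $f:X\times X\times\mathbb R\times\mathbb R\to\mathbb R$ is pairwise symmetric if $f(x,y,w,z)=f(y,x,z,w)$ for all $x,y\in X$, $w,z\in\mathbb R$. A function $f:X\times X\times\mathbb R\times\mathbb R\to\mathbb R$ is called $p$-regular if it is pairwise symmetric and measurable, $(x,y)\mapsto f(x,y,0,0)$ is integrable on $X\times X$, $f_{(x,y)}$ is continuously differentiable for almost all $(x,y)\in X\times X$, and for every $M\in(0,\infty)$ there exist positive functions $\alpha_M\in L^{p^*}(X)\otimes L^1(X)$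 (i.e. $\alpha_M(x,y)$ is a.e. a finite sum $\sum_i u_i(x)v_i(y)$ with $u_i\in L^{p^*}(X)$, $v_i\in L^1(X)$) and $\beta_M\in L^1(X)$ such that \[ |\partial_w f(x,y,w,z)|\le\alpha_M(x,y)+\beta_M(y)\,\mathrm p^{p-1}_M(w) \] for almost all $(x,y)\in X\times X$ and all $w,z\in\mathbb R$ with $|z|\le M$. Let $\mathcal N^p_0$ be the set of all pairwise symmetric, measurable functions $f_0:X\times X\times\mathbb R\times\mathbb R\to\mathbb R$ for which there exist a measurable $g:X\times X\times\mathbb R\to\mathbb R$ and a symmetric $h\in L^1(X\times X)$ such that: for every $M\in(0,\infty)$ there are $a_M\in L^1(X)$ and $C\in(0,\infty)$ with $\int_X|g(x,y,w)|\,dy\le a_M(x)+C\,\mathrm p^p_M(w)$ for almost all $x\in X$ and all $w\in\mathbb R$; $\int_X\int_X h(x,y)\,dx\,dy=0$; $\int_X g(x,y,w)\,dy=0$ for almost all $x\in X$ and all $w\in\mathbb R$; and $f_0(x,y,w,z)=g(x,y,w)+g(y,x,z)+h(x,y)$ for almost all $(x,y)\in X\times X$ and all $w,z\in\mathbb R$.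 **Theorem.** Let $f:X\times X\times\mathbb R\times\mathbb R\to\mathbb R$ be a $p$-regular function such that $f_{(x,y)}$ is twice continuously differentiable for almost all $(x,y)\in X\times X$ and such that for every $M\in(0,\infty)$ there is a function $\alpha_M\in L^1(X\times X)$ with \[ |\partial_w^2 f(x,y,w,z)|\le\alpha_M(x,y) \] for almost all $(x,y)\in X\times X$ and all $w,z\in\mathbb R$ with $|w|\le M$ and $|z|\le M$. For $\psi\in L^p(X)$ let $\Phi_{x,\psi}(w)=\int_X f(x,y,w,\psi(y))\,dy$. Then the following are equivalent: 1. for every $\psi\in L^p(X)$, the function $\Phi_{x,\psi}:\mathbb R\to\mathbb R$ is convex for almost all $x\in X$; 2. there exist a pairwise symmetric, measurable function $\tilde f:X\times X\times\mathbb R\times\mathbb R\to\mathbb R$ and a function $f_0\in\mathcal N^p_0$ such that $\tilde f_{(x,y)}$ is separately convex (i.e. $w\mapsto\tilde f_{(x,y)}(w,z)$ and $w\mapsto\tilde f_{(x,y)}(z,w)$ are convex for every $z\in\mathbb R$) for almost all $(x,y)\in X\times X$, and \[ f(x,y,w,z)=\tilde f(x,y,w,z)+f_0(x,y,w,z) \]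 for almost all $(x,y)\in X\times X$ and all $w,z\in\mathbb R$. -/

import Mathlib

open MeasureTheory Set
open scoped ENNReal

namespace NonLocal

/-- The set `ℝ^m` equipped with the `σ`-algebra of all Lebesgue measurable sets. -/
abbrev LebesgueSpace (m : ℕ) : Type :=
  NullMeasurableSpace (EuclideanSpace ℝ (Fin m)) volume

/-- The (complete) Lebesgue measure on the Lebesgue measurable subsets of `ℝ^m`. -/
noncomputable instance instMeasureSpaceLebesgueSpace (m : ℕ) : MeasureSpace (LebesgueSpace m) where
  volume := (volume : Measure (EuclideanSpace ℝ (Fin m))).completion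

/-- A subset `X` of `ℝ^m`, viewed as a type, carries the trace of the Lebesgue `σ`-algebra and
the restriction of the Lebesgue measure. -/
noncomputable instance instMeasureSpaceSubset {m : ℕ} (X : Set (LebesgueSpace m)) :
    MeasureSpace X :=
  Measure.Subtype.measureSpace

/-- A subset of `ℝ^m` is bounded for the Euclidean distance. -/
def IsBoundedSet {m : ℕ} (X : Set (LebesgueSpace m)) : Prop :=
  Bornology.IsBounded (α := EuclideanSpace ℝ (Fin m)) X

/-- The function `p^q_M(w)`, i.e. `|w|^q` if `q < ∞`, and, if `q = ∞`, `0` for `|w| ≤ M` and `∞`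
for `|w| > M`. -/
noncomputable def pp (q : ℝ≥0∞) (M w : ℝ) : ℝ≥0∞ :=
  if q = ∞ then (if |w| ≤ M then 0 else ∞) else ENNReal.ofReal (|w| ^ q.toReal)

section

variable {m : ℕ} {X : Set (LebesgueSpace m)}

/-- `f(x,y,w,z) = f(y,x,z,w)` for all arguments. -/
def PairwiseSymmetric (f : X → X → ℝ → ℝ → ℝ) : Prop :=
  ∀ x y w z, f x y w z = f y x z w

/-- Measurability of `f : X × X × ℝ × ℝ → ℝ` for the product of the Lebesgue `σ`-algebras on `X`
and the Borel `σ`-algebras on `ℝ`. -/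
def IntegrandMeasurable (f : X → X → ℝ → ℝ → ℝ) : Prop :=
  Measurable fun q : X × X × ℝ × ℝ => f q.1 q.2.1 q.2.2.1 q.2.2.2

/-- `a` belongs to the tensor product `L^q(X) ⊗ L^r(X)`: it is almost everywhere a finite sum of
products `u(x) v(y)` with `u ∈ L^q(X)` and `v ∈ L^r(X)`. -/
def MemTensor (q r : ℝ≥0∞) (a : X → X → ℝ) : Prop :=
  ∃ (k : ℕ) (u v : Fin k → X → ℝ),
    (∀ i, MemLp (u i) q volume) ∧ (∀ i, MemLp (v i) r volume) ∧
      ∀ᵐ s : X × X, a s.1 s.2 = ∑ i, u i s.1 * v i s.2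

/-- `p`-regular integrands `f : X × X × ℝ × ℝ → ℝ`. -/
structure PRegular (p : ℝ≥0∞) (f : X → X → ℝ → ℝ → ℝ) : Prop where
  symmetric : PairwiseSymmetric f
  measurable : IntegrandMeasurable f
  integrable_base : Integrable (fun s : X × X => f s.1 s.2 0 0) volume
  contDiff : ∀ᵐ s : X × X, ContDiff ℝ 1 (fun q : ℝ × ℝ => f s.1 s.2 q.1 q.2)
  bound : ∀ M : ℝ, 0 < M → ∃ (a : X → X → ℝ) (b : X → ℝ),
    (∀ x y, 0 < a x y) ∧ (∀ y, 0 < b y) ∧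
    MemTensor (ENNReal.conjExponent p) 1 a ∧ MemLp b 1 volume ∧
    ∀ᵐ s : X × X, ∀ w z : ℝ, |z| ≤ M →
      ENNReal.ofReal |deriv (fun t => f s.1 s.2 t z) w| ≤
        ENNReal.ofReal (a s.1 s.2) + ENNReal.ofReal (b s.2) * pp (p - 1) M w

/-- The class `N_0^p` of null integrands `g(x,y,w) + g(y,x,z) + h(x,y)`. -/
def MemN0 (p : ℝ≥0∞) (f : X → X → ℝ → ℝ → ℝ) : Prop :=
  PairwiseSymmetric f ∧ IntegrandMeasurable f ∧
  ∃ (g : X → X → ℝ → ℝ) (h : X → X → ℝ),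
    Measurable (fun q : X × X × ℝ => g q.1 q.2.1 q.2.2) ∧
    Integrable (fun s : X × X => h s.1 s.2) volume ∧
    (∀ x y, h x y = h y x) ∧
    (∀ M : ℝ, 0 < M → ∃ (a : X → ℝ) (C : ℝ), MemLp a 1 volume ∧ 0 < C ∧
      ∀ᵐ x : X, ∀ w : ℝ,
        ∫⁻ y : X, ENNReal.ofReal |g x y w| ≤
          ENNReal.ofReal (a x) + ENNReal.ofReal C * pp p M w) ∧
    ∫ x : X, ∫ y : X, h x y = 0 ∧
    (∀ᵐ x : X, ∀ w : ℝ, ∫ y : X, g x y w = 0) ∧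
    ∀ᵐ s : X × X, ∀ w z : ℝ, f s.1 s.2 w z = g s.1 s.2 w + g s.2 s.1 z + h s.1 s.2

/-- The function `Φ_{x,ψ}(w) = ∫_X f(x,y,w,ψ(y)) dy`. -/
noncomputable def Phi (f : X → X → ℝ → ℝ → ℝ) (x : X) (ψ : X → ℝ) (w : ℝ) : ℝ :=
  ∫ y : X, f x y w (ψ y)

end

/-- A function on `ℝ × ℝ` is separately convex if it is convex in each variable. -/
def SeparatelyConvex (φ : ℝ → ℝ → ℝ) : Prop :=
  (∀ z, ConvexOn ℝ univ fun w => φ w z) ∧ ∀ z, ConvexOn ℝ univ fun w => φ z w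

end NonLocal

/-! Fix `x` and write `u y w z` for the integrand, with `w`-derivatives `u₁`, `u₂`. Convexity of
`Φ_{x,ψ}` for bounded `ψ` says `∫ u₂ y w (ψ y) dy ≥ 0`. Letting `ψ(y)` approach a minimiser of `z ↦
u₂ y w z` gives `∫ inf_z u₂ y w z dy ≥ 0` (`lintegral_supGap_le`). Let `g(x,y,·)` vanish to first
order at `0` and have second derivative `inf_z u₂ y w z` minus the mean of this infimum over `y`.
Then `∫ g dy = 0`, and `f - g` is convex in `w`, because its second derivative is `(u₂ - inf_z u₂)`
plus a nonnegative mean. Subtracting `g(y,x,z)` as well restores pairwise symmetry and gives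
separate convexity, with `h = 0`.

The infimum is only measurable in `w`, so `g` is built from the Taylor kernel rather than by
differentiation, in `[0,∞]` where Tonelli is free: `nullPart` is the first order remainder of `u y w
0` minus `convexPart`. By Tonelli and Taylor both have the same integral over `y`
(`lintegral_convexPart`), which yields both `∫ g dy = 0` and the growth bound. Since `∀ ψ, ∀ᵐ x`
must become `∀ᵐ x, ∀ ψ`, only countably many `ψ` are used, dense in a suitable sense
(`exists_countable_dense_bounded`).

Conversely, `g(x,y,w)` integrates to zero over `y`, and `g(y,x,ψ(y)) + h(x,y)` contributes a
constant in `w`. Hence `Φ_{x,ψ}` is an integral of convex functions plus a constant; what has to be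
checked is integrability. -/

namespace NonLocal

/-! ### The kernel of Taylor's formula at `0` -/

/-- The kernel `|w - t|` on the segment joining `0` and `w`, extended by `0`. -/
noncomputable def taylorKernel (t w : ℝ) : ℝ :=
  if 0 < t then max (w - t) 0 else max (t - w) 0

lemma taylorKernel_nonneg (t w : ℝ) : 0 ≤ taylorKernel t w := by
  unfold taylorKernel; split_ifs <;> exact le_max_right _ _

lemma taylorKernel_eq_zero {t w : ℝ} (h : |w| < |t|) : taylorKernel t w = 0 := by
  unfold taylorKernel
  have h1 := le_abs_self w
  have h2 := neg_abs_le w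
  split_ifs with h0
  · rw [abs_of_pos h0] at h
    exact max_eq_right (by linarith)
  · rw [abs_of_nonpos (not_lt.1 h0)] at h
    exact max_eq_right (by linarith)

lemma taylorKernel_le (t w : ℝ) : taylorKernel t w ≤ |w| := by
  unfold taylorKernel
  have h1 := le_abs_self w
  have h2 := neg_abs_le w
  split_ifs with h0
  · exact max_le (by linarith) (abs_nonneg w)
  · exact max_le (by linarith) (abs_nonneg w)

lemma measurable_taylorKernel : Measurable fun q : ℝ × ℝ => taylorKernel q.1 q.2 := by
  unfold taylorKernel
  refine Measurable.ite (measurableSet_lt measurable_const measurable_fst) ?_ ?_ <;> fun_prop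

lemma convexOn_taylorKernel (t : ℝ) : ConvexOn ℝ univ (taylorKernel t) := by
  unfold taylorKernel
  split_ifs
  · exact (((convexOn_id convex_univ).sub (concaveOn_const t convex_univ)).sup
      (convexOn_const 0 convex_univ))
  · exact (((convexOn_const t convex_univ).sub (concaveOn_id convex_univ)).sup
      (convexOn_const 0 convex_univ))

/-- The kernel is monotone in `w`, in a direction given by the sign of `t`; the sum covers both
cases. This reduces finiteness for all `w` to integer `w`. -/
lemma taylorKernel_mono {t v w : ℝ} (h : |w| ≤ v) :
    taylorKernel t w ≤ taylorKernel t v + taylorKernel t (-v) := by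
  have h1 := (abs_le.1 h).1
  have h2 := (abs_le.1 h).2
  unfold taylorKernel
  split_ifs with h0
  · exact le_add_of_le_of_nonneg (max_le_max_right _ (by linarith)) (le_max_right _ _)
  · exact le_add_of_nonneg_of_le (le_max_right _ _) (max_le_max_right _ (by linarith))

lemma integrable_taylorKernel_mul {u : ℝ → ℝ} (hu : Continuous u) (w : ℝ) :
    Integrable fun t => taylorKernel t w * u t := by
  have h1 : IntegrableOn (fun t => |w| * |u t|) (Icc (-|w|) |w|) :=
    (continuous_const.mul hu.abs).continuousOn.integrableOn_Icc
  have hm : AEStronglyMeasurable (fun t => taylorKernel t w * u t) volume :=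
    ((measurable_taylorKernel.comp (measurable_id.prodMk measurable_const)).mul
      hu.measurable).aestronglyMeasurable
  refine ((integrable_indicator_iff measurableSet_Icc).2 h1).mono hm
    (Filter.Eventually.of_forall fun t => ?_)
  by_cases ht : |w| < |t|
  · simp [taylorKernel_eq_zero ht]
  · rw [indicator_of_mem (by rw [mem_Icc]; exact abs_le.1 (not_lt.1 ht))]
    simp only [norm_mul, Real.norm_eq_abs, abs_abs, abs_of_nonneg (taylorKernel_nonneg t w)]
    exact mul_le_mul_of_nonneg_right (taylorKernel_le t w) (abs_nonneg _)

/-- Taylor's formula of order two at `0` with integral remainder. -/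
lemma integral_taylorKernel_mul {u u₁ u₂ : ℝ → ℝ} (h₁ : ∀ t, HasDerivAt u (u₁ t) t)
    (h₂ : ∀ t, HasDerivAt u₁ (u₂ t) t) (hc : Continuous u₂) (w : ℝ) :
    ∫ t, taylorKernel t w * u₂ t = u w - u 0 - u₁ 0 * w := by
  rcases le_total 0 w with hw | hw
  · have h : ∀ t, taylorKernel t w * u₂ t
        = (Ioc 0 w).indicator (fun t => (w - t) * u₂ t) t := by
      intro t
      by_cases ht : t ∈ Ioc 0 w
      · rw [indicator_of_mem ht, taylorKernel, if_pos ht.1, max_eq_left (by linarith [ht.2])]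
      · rw [indicator_of_notMem ht, taylorKernel]
        split_ifs with h0
        · have : w < t := not_le.1 fun h' => ht ⟨h0, h'⟩
          rw [max_eq_right (by linarith), zero_mul]
        · rw [max_eq_right (by linarith), zero_mul]
    have hd : ∀ t ∈ uIcc 0 w,
        HasDerivAt (fun t => (w - t) * u₁ t + u t) ((w - t) * u₂ t) t := by
      intro t _
      have := (((hasDerivAt_id t).const_sub w).mul (h₂ t)).add (h₁ t)
      refine this.congr_deriv ?_
      simp
    simp_rw [h]
    rw [integral_indicator measurableSet_Ioc, ← intervalIntegral.integral_of_le hw,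
      intervalIntegral.integral_eq_sub_of_hasDerivAt hd
        (Continuous.intervalIntegrable (by fun_prop) _ _)]
    ring
  · have h : ∀ t, taylorKernel t w * u₂ t
        = (Ioc w 0).indicator (fun t => (t - w) * u₂ t) t := by
      intro t
      by_cases ht : t ∈ Ioc w 0
      · rw [indicator_of_mem ht, taylorKernel, if_neg (not_lt.2 ht.2),
          max_eq_left (by linarith [ht.1])]
      · rw [indicator_of_notMem ht, taylorKernel]
        split_ifs with h0
        · rw [max_eq_right (by linarith), zero_mul]
        · have : t ≤ w := not_lt.1 fun h' => ht ⟨h', not_lt.1 h0⟩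
          rw [max_eq_right (by linarith), zero_mul]
    have hd : ∀ t ∈ uIcc w 0,
        HasDerivAt (fun t => (t - w) * u₁ t - u t) ((t - w) * u₂ t) t := by
      intro t _
      have := (((hasDerivAt_id t).sub_const w).mul (h₂ t)).sub (h₁ t)
      refine this.congr_deriv ?_
      simp
    simp_rw [h]
    rw [integral_indicator measurableSet_Ioc, ← intervalIntegral.integral_of_le hw,
      intervalIntegral.integral_eq_sub_of_hasDerivAt hd
        (Continuous.intervalIntegrable (by fun_prop) _ _)]
    ring

/-- The kernel is convex in `w`, so no continuity of the weight `H`, which acts as second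
derivative, is needed. -/
lemma convexOn_integral_taylorKernel {H : ℝ → ℝ} (hH : ∀ᵐ t, 0 ≤ H t)
    (hi : ∀ w, Integrable fun t => taylorKernel t w * H t) :
    ConvexOn ℝ univ fun w => ∫ t, taylorKernel t w * H t := by
  refine ⟨convex_univ, fun v _ w _ a b ha hb hab => ?_⟩
  simp only [smul_eq_mul]
  rw [← integral_const_mul, ← integral_const_mul,
    ← integral_add ((hi v).const_mul a) ((hi w).const_mul b)]
  refine integral_mono_ae (hi _) (((hi v).const_mul a).add ((hi w).const_mul b)) ?_
  filter_upwards [hH] with t ht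
  have := (convexOn_taylorKernel t).2 (mem_univ v) (mem_univ w) ha hb hab
  simp only [smul_eq_mul] at this
  have := mul_le_mul_of_nonneg_right this ht
  linarith

lemma convexOn_integral {Ω : Type*} [MeasurableSpace Ω] {μ : Measure Ω} {F : ℝ → Ω → ℝ}
    (hF : ∀ᵐ y ∂μ, ConvexOn ℝ univ fun w => F w y) (hi : ∀ w, Integrable (F w) μ) :
    ConvexOn ℝ univ fun w => ∫ y, F w y ∂μ := by
  refine ⟨convex_univ, fun v _ w _ a b ha hb hab => ?_⟩
  simp only [smul_eq_mul]
  rw [← integral_const_mul, ← integral_const_mul,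
    ← integral_add ((hi v).const_mul a) ((hi w).const_mul b)]
  refine integral_mono_ae (hi _) (((hi v).const_mul a).add ((hi w).const_mul b)) ?_
  filter_upwards [hF] with y hy
  simpa using hy.2 (mem_univ v) (mem_univ w) ha hb hab

/-! ### Measure theoretic preliminaries -/

/-- Needed for separability of `L¹(X)`. The Lebesgue `σ`-algebra need not be countably generated, so
traces of a countable measure-dense family are used instead. -/
instance isSeparable_volume_subtype {m : ℕ} (X : Set (LebesgueSpace m)) [hX : Fact (MeasurableSet X)] :
    IsSeparable (volume : Measure X) := by
  have : IsSeparable (volume : Measure (LebesgueSpace m)) :=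
    inferInstanceAs (IsSeparable (volume : Measure (EuclideanSpace ℝ (Fin m))).completion)
  obtain ⟨𝒜, hc, hd⟩ := exists_countable_measureDense (volume : Measure (LebesgueSpace m))
  have hap : ∀ s : Set X, (volume : Measure X) s = volume (Subtype.val '' s) := fun s =>
    (MeasurableEmbedding.subtype_coe hX.out).comap_apply _ s
  refine ⟨(fun s => Subtype.val ⁻¹' s) '' 𝒜, hc.image _, ⟨?_, ?_⟩⟩
  · rintro _ ⟨s, hs, rfl⟩
    exact measurable_subtype_coe (hd.measurable s hs)
  · intro s hs hfin ε hε
    obtain ⟨t, ht, hlt⟩ := hd.approx _ (hX.out.subtype_image hs) (by rwa [← hap]) ε hε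
    refine ⟨_, ⟨t, ht, rfl⟩, lt_of_le_of_lt ?_ hlt⟩
    rw [hap]
    refine measure_mono ?_
    rintro _ ⟨y, hy, rfl⟩
    rcases hy with ⟨h1, h2⟩ | ⟨h1, h2⟩
    · exact Or.inl ⟨⟨y, h1, rfl⟩, h2⟩
    · refine Or.inr ⟨h1, ?_⟩
      rintro ⟨z, hz, hzy⟩
      exact h2 (Subtype.ext hzy ▸ hz)

lemma isFiniteMeasure_volume_subtype {m : ℕ} {X : Set (LebesgueSpace m)} (hX : MeasurableSet X)
    (hb : IsBoundedSet X) : IsFiniteMeasure (volume : Measure X) := by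
  refine ⟨?_⟩
  have h : (volume : Measure X) univ = volume (Subtype.val '' (univ : Set X)) :=
    (MeasurableEmbedding.subtype_coe hX).comap_apply _ _
  rw [h, image_univ, Subtype.range_coe]
  have h2 : (volume : Measure (EuclideanSpace ℝ (Fin m))) X < ∞ :=
    Bornology.IsBounded.measure_lt_top hb
  exact h2

/-! ### Test functions and the infimum over `z`, at fixed `x` -/

section Generic

variable {Ω : Type*} [MeasurableSpace Ω] {μ : Measure Ω}

/-- A finite separable measure admits a countable family of bounded measurable functions such
that each bounded measurable function is the pointwise limit of a sequence from that family with
the same bound. -/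
lemma exists_countable_dense_bounded (μ : Measure Ω) [IsFiniteMeasure μ] [IsSeparable μ] (n : ℕ) :
    ∃ d : ℕ → Ω → ℝ, (∀ i, Measurable (d i)) ∧ (∀ i y, |d i y| ≤ n) ∧
      ∀ ψ : Ω → ℝ, Measurable ψ → (∀ y, |ψ y| ≤ n) → ∃ k : ℕ → ℕ, ∀ᵐ y ∂μ,
        Filter.Tendsto (fun i => d (k i) y) Filter.atTop (nhds (ψ y)) := by
  have hn : (0 : ℝ) ≤ n := n.cast_nonneg
  -- Truncation is continuous and fixes `[-n, n]`: it bounds a dense sequence of `L¹` without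
  -- changing the limits of interest.
  let c : ℝ → ℝ := fun t => max (-n : ℝ) (min n t)
  have hc : Continuous c := by fun_prop
  have hcb : ∀ t, |c t| ≤ n := fun t =>
    abs_le.2 ⟨le_max_left _ _, max_le (by linarith) (min_le_left _ _)⟩
  have hce : ∀ t : ℝ, |t| ≤ n → c t = t := fun t ht => by
    have := abs_le.1 ht
    simp only [c]
    rw [min_eq_right this.2, max_eq_right this.1]
  have : Fact ((1 : ℝ≥0∞) ≠ ∞) := ⟨ENNReal.one_ne_top⟩
  let D := TopologicalSpace.denseSeq (Lp ℝ 1 μ)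
  have hD : DenseRange D := TopologicalSpace.denseRange_denseSeq _
  refine ⟨fun i y => c (D i y), fun i => hc.measurable.comp (Lp.stronglyMeasurable _).measurable,
    fun i y => hcb _, fun ψ hψ hb => ?_⟩
  have hL : MemLp ψ 1 μ := (MemLp.of_bound hψ.aestronglyMeasurable (n : ℝ)
    (Filter.Eventually.of_forall hb))
  obtain ⟨s, hs, hlim⟩ := mem_closure_iff_seq_limit.1 (hD (hL.toLp ψ))
  choose i hi using hs
  obtain ⟨ns, -, hns⟩ := (tendstoInMeasure_of_tendsto_Lp hlim).exists_seq_tendsto_ae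
  refine ⟨fun j => i (ns j), ?_⟩
  filter_upwards [hns, hL.coeFn_toLp] with y hy h2
  rw [h2] at hy
  have := (hc.tendsto _).comp hy
  rw [hce _ (hb y)] at this
  simp only [hi]
  exact this

/-- A family `u y w z` with first and second derivatives `u₁`, `u₂` with respect to `w`, all of
which are measurable and dominated by an integrable function of `y` for bounded `w` and `z`. -/
structure DominatedFamily (μ : Measure Ω) (u u₁ u₂ : Ω → ℝ → ℝ → ℝ) : Prop where
  meas : Measurable fun q : Ω × ℝ × ℝ => u q.1 q.2.1 q.2.2
  meas₁ : Measurable fun q : Ω × ℝ × ℝ => u₁ q.1 q.2.1 q.2.2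
  meas₂ : Measurable fun q : Ω × ℝ × ℝ => u₂ q.1 q.2.1 q.2.2
  deriv₁ : ∀ y w z, HasDerivAt (fun t => u y t z) (u₁ y w z) w
  deriv₂ : ∀ y w z, HasDerivAt (fun t => u₁ y t z) (u₂ y w z) w
  cont : ∀ y, Continuous fun q : ℝ × ℝ => u₂ y q.1 q.2
  dom : ∀ n : ℕ, ∃ A : Ω → ℝ, Integrable A μ ∧ ∀ᵐ y ∂μ, ∀ w z : ℝ, |w| ≤ n → |z| ≤ n →
    |u y w z| ≤ A y ∧ |u₁ y w z| ≤ A y ∧ |u₂ y w z| ≤ A y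

/-- The excess `sup_z (v 0 - v z)⁺` over rational `z`. -/
noncomputable def supGap (v : ℝ → ℝ) : ℝ≥0∞ := ⨆ q : ℚ, ENNReal.ofReal (v 0 - v q)

lemma le_supGap {v : ℝ → ℝ} (hv : Continuous v) (z : ℝ) :
    ENNReal.ofReal (v 0 - v z) ≤ supGap v := by
  have hc : Continuous fun z => ENNReal.ofReal (v 0 - v z) :=
    ENNReal.continuous_ofReal.comp (continuous_const.sub hv)
  have h : ∀ z ∈ closure (range ((↑) : ℚ → ℝ)), z ∈ {z | ENNReal.ofReal (v 0 - v z) ≤ supGap v} := by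
    intro z hz
    refine closure_minimal ?_ (isClosed_le hc continuous_const) hz
    rintro _ ⟨q, rfl⟩
    exact le_iSup (fun q : ℚ => ENNReal.ofReal (v 0 - v q)) q
  exact h z (Rat.denseRange_cast z)

namespace DominatedFamily

variable {u u₁ u₂ : Ω → ℝ → ℝ → ℝ}

lemma exists_nat_bound (w : ℝ) (n : ℕ) : ∃ k : ℕ, |w| + 1 ≤ k ∧ n ≤ k := by
  obtain ⟨k, hk⟩ := exists_nat_ge (|w| + 1)
  exact ⟨max k n, hk.trans (by exact_mod_cast le_max_left k n), le_max_right _ _⟩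

lemma abs_le_of_mem_ball {w t : ℝ} {k : ℕ} (hk : |w| + 1 ≤ k) (ht : t ∈ Metric.ball w 1) :
    |t| ≤ k := by
  rw [Metric.mem_ball, Real.dist_eq] at ht
  have : |t| ≤ |t - w| + |w| := by simpa using abs_add_le (t - w) w
  linarith

lemma measurable_comp {v : Ω → ℝ → ℝ → ℝ} (hv : Measurable fun q : Ω × ℝ × ℝ => v q.1 q.2.1 q.2.2)
    {ψ : Ω → ℝ} (hψ : Measurable ψ) (w : ℝ) : Measurable fun y => v y w (ψ y) :=
  hv.comp (measurable_id.prodMk (measurable_const.prodMk hψ))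

lemma integrable (h : DominatedFamily μ u u₁ u₂) {ψ : Ω → ℝ} (hψ : Measurable ψ) {n : ℕ}
    (hn : ∀ y, |ψ y| ≤ n) (w : ℝ) :
    Integrable (fun y => u y w (ψ y)) μ ∧ Integrable (fun y => u₁ y w (ψ y)) μ ∧
      Integrable (fun y => u₂ y w (ψ y)) μ := by
  obtain ⟨k, hk, hnk⟩ := exists_nat_bound w n
  obtain ⟨A, hA, hb⟩ := h.dom k
  have hw : |w| ≤ k := by linarith
  have hz : ∀ y, |ψ y| ≤ k := fun y => (hn y).trans (by exact_mod_cast hnk)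
  refine ⟨hA.mono' (measurable_comp h.meas hψ w).aestronglyMeasurable ?_,
    hA.mono' (measurable_comp h.meas₁ hψ w).aestronglyMeasurable ?_,
    hA.mono' (measurable_comp h.meas₂ hψ w).aestronglyMeasurable ?_⟩ <;>
  filter_upwards [hb] with y hy
  exacts [(hy w _ hw (hz y)).1, (hy w _ hw (hz y)).2.1, (hy w _ hw (hz y)).2.2]

lemma hasDerivAt_integral (h : DominatedFamily μ u u₁ u₂) {ψ : Ω → ℝ} (hψ : Measurable ψ) {n : ℕ}
    (hn : ∀ y, |ψ y| ≤ n) (w : ℝ) :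
    HasDerivAt (fun w => ∫ y, u y w (ψ y) ∂μ) (∫ y, u₁ y w (ψ y) ∂μ) w ∧
      HasDerivAt (fun w => ∫ y, u₁ y w (ψ y) ∂μ) (∫ y, u₂ y w (ψ y) ∂μ) w := by
  obtain ⟨k, hk, hnk⟩ := exists_nat_bound w n
  obtain ⟨A, hA, hb⟩ := h.dom k
  have hz : ∀ y, |ψ y| ≤ k := fun y => (hn y).trans (by exact_mod_cast hnk)
  constructor
  · refine (hasDerivAt_integral_of_dominated_loc_of_deriv_le (Metric.ball_mem_nhds w one_pos)
      (Filter.Eventually.of_forall fun t => (measurable_comp h.meas hψ t).aestronglyMeasurable)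
      (h.integrable hψ hn w).1 (F' := fun t y => u₁ y t (ψ y))
      (measurable_comp h.meas₁ hψ w).aestronglyMeasurable ?_ hA ?_).2
    · filter_upwards [hb] with y hy t ht
      exact (hy t _ (abs_le_of_mem_ball hk ht) (hz y)).2.1
    · exact Filter.Eventually.of_forall fun y t _ => h.deriv₁ y t _
  · refine (hasDerivAt_integral_of_dominated_loc_of_deriv_le (Metric.ball_mem_nhds w one_pos)
      (Filter.Eventually.of_forall fun t => (measurable_comp h.meas₁ hψ t).aestronglyMeasurable)
      (h.integrable hψ hn w).2.1 (F' := fun t y => u₂ y t (ψ y))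
      (measurable_comp h.meas₂ hψ w).aestronglyMeasurable ?_ hA ?_).2
    · filter_upwards [hb] with y hy t ht
      exact (hy t _ (abs_le_of_mem_ball hk ht) (hz y)).2.2
    · exact Filter.Eventually.of_forall fun y t _ => h.deriv₂ y t _

lemma continuous_integral (h : DominatedFamily μ u u₁ u₂) {ψ : Ω → ℝ} (hψ : Measurable ψ) {n : ℕ}
    (hn : ∀ y, |ψ y| ≤ n) : Continuous fun w => ∫ y, u₂ y w (ψ y) ∂μ := by
  refine continuous_iff_continuousAt.2 fun w => ?_
  obtain ⟨k, hk, hnk⟩ := exists_nat_bound w n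
  obtain ⟨A, hA, hb⟩ := h.dom k
  have hz : ∀ y, |ψ y| ≤ k := fun y => (hn y).trans (by exact_mod_cast hnk)
  refine continuousAt_of_dominated
    (Filter.Eventually.of_forall fun t => (measurable_comp h.meas₂ hψ t).aestronglyMeasurable)
    (bound := A) ?_ hA ?_
  · filter_upwards [Metric.ball_mem_nhds w one_pos] with t ht
    filter_upwards [hb] with y hy
    exact (hy t _ (abs_le_of_mem_ball hk ht) (hz y)).2.2
  · refine Filter.Eventually.of_forall fun y => ?_
    exact ((h.cont y).comp (continuous_id.prodMk continuous_const)).continuousAt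

lemma integral_nonneg_of_convexOn (h : DominatedFamily μ u u₁ u₂) {ψ : Ω → ℝ} (hψ : Measurable ψ)
    {n : ℕ} (hn : ∀ y, |ψ y| ≤ n) (hc : ConvexOn ℝ univ fun w => ∫ y, u y w (ψ y) ∂μ) (w : ℝ) :
    0 ≤ ∫ y, u₂ y w (ψ y) ∂μ := by
  have h1 := fun w => (h.hasDerivAt_integral hψ hn w).1
  have h2 := (h.hasDerivAt_integral hψ hn w).2
  have hm := hc.monotoneOn_deriv (fun x _ => (h1 x).differentiableAt)
  have he : deriv (fun w => ∫ y, u y w (ψ y) ∂μ) = fun w => ∫ y, u₁ y w (ψ y) ∂μ :=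
    funext fun w => (h1 w).deriv
  rw [he, monotoneOn_univ] at hm
  rw [← h2.deriv]
  exact hm.deriv_nonneg

/-- Dominated convergence passes from the countable family to every bounded `ψ`, so that one null
set of `x` serves all `ψ`. -/
lemma integral_nonneg_of_dense (h : DominatedFamily μ u u₁ u₂) {n : ℕ} {d : ℕ → Ω → ℝ}
    (hd : ∀ i, Measurable (d i)) (hdn : ∀ i y, |d i y| ≤ n) {ψ : Ω → ℝ} {k : ℕ → ℕ}
    (hlim : ∀ᵐ y ∂μ, Filter.Tendsto (fun i => d (k i) y) Filter.atTop (nhds (ψ y)))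
    {w : ℝ} (hpos : ∀ i, 0 ≤ ∫ y, u₂ y w (d i y) ∂μ) :
    0 ≤ ∫ y, u₂ y w (ψ y) ∂μ := by
  obtain ⟨j, hj, hnj⟩ := exists_nat_bound w n
  obtain ⟨A, hA, hb⟩ := h.dom j
  have hw : |w| ≤ j := by linarith
  have hz : ∀ i y, |d i y| ≤ j := fun i y => (hdn i y).trans (by exact_mod_cast hnj)
  refine ge_of_tendsto' (tendsto_integral_of_dominated_convergence A
    (F := fun i y => u₂ y w (d (k i) y))
    (fun i => (measurable_comp h.meas₂ (hd _) w).aestronglyMeasurable) hA ?_ ?_)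
    fun i => hpos (k i)
  · intro i
    filter_upwards [hb] with y hy
    exact (hy w _ hw (hz _ y)).2.2
  · filter_upwards [hlim] with y hy
    exact (((h.cont y).comp (continuous_const.prodMk continuous_id)).tendsto (ψ y)).comp hy

/-- If the integral of `u₂ y w (ψ y)` is nonnegative for all bounded measurable `ψ`, then so is the
integral of `inf_z u₂ y w z`. -/
lemma lintegral_supGap_le (h : DominatedFamily μ u u₁ u₂) {w : ℝ}
    (hpos : ∀ (n : ℕ) (ψ : Ω → ℝ), Measurable ψ → (∀ y, |ψ y| ≤ n) →
      0 ≤ ∫ y, u₂ y w (ψ y) ∂μ) :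
    ∫⁻ y, supGap (u₂ y w) ∂μ ≤ ENNReal.ofReal (∫ y, u₂ y w 0 ∂μ) := by
  classical
  obtain ⟨e, he⟩ := exists_surjective_nat ℚ
  -- `ψ N y` minimises `u₂ y w` over `0` and the first `N` rationals of the enumeration. It is
  -- measurable and bounded, and the gaps `G N` increase, so monotone convergence replaces a
  -- measurable selection.
  let ψ : ℕ → Ω → ℝ := fun N => N.rec (fun _ => 0)
    fun i φ y => if u₂ y w (e i) < u₂ y w (φ y) then e i else φ y
  have hs : ∀ i y, ψ (i + 1) y = if u₂ y w (e i) < u₂ y w (ψ i y) then (e i : ℝ) else ψ i y :=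
    fun i y => rfl
  have hψm : ∀ N, Measurable (ψ N) := by
    intro N
    induction N with
    | zero => exact measurable_const
    | succ i ih =>
      simp only [funext (hs i)]
      exact Measurable.ite (measurableSet_lt (measurable_comp h.meas₂ measurable_const w)
        (measurable_comp h.meas₂ ih w)) measurable_const ih
  have hψb : ∀ N, ∃ n : ℕ, ∀ y, |ψ N y| ≤ n := by
    intro N
    induction N with
    | zero => exact ⟨0, fun y => by simp [ψ]⟩
    | succ i ih =>
      obtain ⟨n, hn⟩ := ih
      obtain ⟨k, hk, hnk⟩ := exists_nat_bound (e i) n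
      refine ⟨k, fun y => ?_⟩
      rw [hs]
      split_ifs
      · linarith
      · exact (hn y).trans (by exact_mod_cast hnk)
  let G : ℕ → Ω → ℝ := fun N y => u₂ y w 0 - u₂ y w (ψ N y)
  have hGs : ∀ i y, G (i + 1) y = max (G i y) (u₂ y w 0 - u₂ y w (e i)) := by
    intro i y
    simp only [G, hs]
    split_ifs with h1
    · rw [max_eq_right (by linarith)]
    · rw [max_eq_left (by linarith)]
  have hGm : ∀ y, Monotone fun N => G N y := fun y =>
    monotone_nat_of_le_succ fun i => by rw [hGs]; exact le_max_left _ _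
  have hG0 : ∀ N y, 0 ≤ G N y := fun N y => by
    have := hGm y (Nat.zero_le N)
    simpa [G, ψ] using this
  have hgap : ∀ y, supGap (u₂ y w) ≤ ⨆ N, ENNReal.ofReal (G N y) := by
    intro y
    refine iSup_le fun q => ?_
    obtain ⟨i, rfl⟩ := he q
    refine le_iSup_of_le (i + 1) (ENNReal.ofReal_le_ofReal ?_)
    rw [hGs]
    exact le_max_right _ _
  have hGmeas : ∀ N, Measurable (G N) := fun N =>
    (measurable_comp h.meas₂ measurable_const w).sub (measurable_comp h.meas₂ (hψm N) w)
  calc ∫⁻ y, supGap (u₂ y w) ∂μ ≤ ∫⁻ y, ⨆ N, ENNReal.ofReal (G N y) ∂μ := lintegral_mono hgap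
    _ = ⨆ N, ∫⁻ y, ENNReal.ofReal (G N y) ∂μ :=
      lintegral_iSup (fun N => (hGmeas N).ennreal_ofReal)
        fun i j hij y => ENNReal.ofReal_le_ofReal (hGm y hij)
    _ ≤ _ := by
      refine iSup_le fun N => ?_
      obtain ⟨n, hn⟩ := hψb N
      have h0 := (h.integrable (ψ := fun _ => 0) measurable_const (n := 0) (by simp) w).2.2
      have h1 := (h.integrable (hψm N) hn w).2.2
      have h01 : Integrable (G N) μ := h0.sub h1
      rw [← ofReal_integral_eq_lintegral_ofReal h01
        (Filter.Eventually.of_forall (hG0 N))]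
      refine ENNReal.ofReal_le_ofReal ?_
      have := hpos n (ψ N) (hψm N) hn
      rw [show ∫ y, G N y ∂μ = _ - _ from integral_sub h0 h1]
      linarith

end DominatedFamily

/-! ### Construction of the null function at fixed `x` -/

lemma measurable_taylorKernel_left (w : ℝ) : Measurable fun t => taylorKernel t w :=
  measurable_taylorKernel.comp (f := fun t : ℝ => (t, w)) (by fun_prop)

/-- The mean value over `y` of `inf_z v y t z`, if that is nonnegative. -/
noncomputable def meanInf (μ : Measure Ω) (v : Ω → ℝ → ℝ → ℝ) (t : ℝ) : ℝ≥0∞ :=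
  (ENNReal.ofReal (∫ y, v y t 0 ∂μ) - ∫⁻ y, supGap (v y t) ∂μ) / μ univ

/-- The quantity `v y t 0 - inf_z v y t z + meanInf μ v t`. -/
noncomputable def curvature (μ : Measure Ω) (v : Ω → ℝ → ℝ → ℝ) (y : Ω) (t : ℝ) : ℝ≥0∞ :=
  supGap (v y t) + meanInf μ v t

/-- The convex function of `w` that vanishes to first order at `0` and has second derivative
`curvature μ v y`. -/
noncomputable def convexPart (μ : Measure Ω) (v : Ω → ℝ → ℝ → ℝ) (y : Ω) (w : ℝ) : ℝ≥0∞ :=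
  ∫⁻ t, ENNReal.ofReal (taylorKernel t w) * curvature μ v y t

/-- The function `g(y,w)` with vanishing integral over `y` that has to be subtracted from
`u y w z` to make it convex in `w`. -/
noncomputable def nullPart (μ : Measure Ω) (u u₁ u₂ : Ω → ℝ → ℝ → ℝ) (y : Ω) (w : ℝ) : ℝ :=
  u y w 0 - u y 0 0 - u₁ y 0 0 * w - (convexPart μ u₂ y w).toReal

section Measurability

variable {Ω' : Type*} [MeasurableSpace Ω'] {V : Ω' → Ω → ℝ → ℝ → ℝ}

lemma measurable_supGap (hV : Measurable fun q : Ω' × Ω × ℝ × ℝ => V q.1 q.2.1 q.2.2.1 q.2.2.2) :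
    Measurable fun q : Ω' × Ω × ℝ => supGap (V q.1 q.2.1 q.2.2) := by
  unfold supGap
  refine Measurable.iSup fun r => Measurable.ennreal_ofReal (Measurable.sub ?_ ?_)
  · exact hV.comp (g := fun q : Ω' × Ω × ℝ × ℝ => V q.1 q.2.1 q.2.2.1 q.2.2.2)
      (f := fun q : Ω' × Ω × ℝ => (q.1, q.2.1, q.2.2, (0 : ℝ))) (by fun_prop)
  · exact hV.comp (g := fun q : Ω' × Ω × ℝ × ℝ => V q.1 q.2.1 q.2.2.1 q.2.2.2)
      (f := fun q : Ω' × Ω × ℝ => (q.1, q.2.1, q.2.2, (r : ℝ))) (by fun_prop)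

lemma measurable_meanInf [SFinite μ]
    (hV : Measurable fun q : Ω' × Ω × ℝ × ℝ => V q.1 q.2.1 q.2.2.1 q.2.2.2) :
    Measurable fun q : Ω' × ℝ => meanInf μ (V q.1) q.2 := by
  unfold meanInf
  refine Measurable.div_const (Measurable.sub (Measurable.ennreal_ofReal ?_) ?_) _
  · have : Measurable fun q : (Ω' × ℝ) × Ω => V q.1.1 q.2 q.1.2 0 :=
      hV.comp (g := fun q : Ω' × Ω × ℝ × ℝ => V q.1 q.2.1 q.2.2.1 q.2.2.2)
        (f := fun q : (Ω' × ℝ) × Ω => (q.1.1, q.2, q.1.2, (0 : ℝ))) (by fun_prop)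
    exact (StronglyMeasurable.integral_prod_right' (ν := μ) this.stronglyMeasurable).measurable
  · have : Measurable fun q : (Ω' × ℝ) × Ω => supGap (V q.1.1 q.2 q.1.2) :=
      (measurable_supGap hV).comp (f := fun q : (Ω' × ℝ) × Ω => (q.1.1, q.2, q.1.2)) (by fun_prop)
    exact this.lintegral_prod_right'

lemma measurable_curvature [SFinite μ]
    (hV : Measurable fun q : Ω' × Ω × ℝ × ℝ => V q.1 q.2.1 q.2.2.1 q.2.2.2) :
    Measurable fun q : Ω' × Ω × ℝ => curvature μ (V q.1) q.2.1 q.2.2 :=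
  (measurable_supGap hV).add
    ((measurable_meanInf hV).comp (f := fun q : Ω' × Ω × ℝ => (q.1, q.2.2)) (by fun_prop))

lemma measurable_convexPart [SFinite μ]
    (hV : Measurable fun q : Ω' × Ω × ℝ × ℝ => V q.1 q.2.1 q.2.2.1 q.2.2.2) :
    Measurable fun q : Ω' × Ω × ℝ => convexPart μ (V q.1) q.2.1 q.2.2 := by
  unfold convexPart
  refine Measurable.lintegral_prod_right' (ν := volume)
    (f := fun q : (Ω' × Ω × ℝ) × ℝ =>
      ENNReal.ofReal (taylorKernel q.2 q.1.2.2) * curvature μ (V q.1.1) q.1.2.1 q.2) ?_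
  refine Measurable.mul ?_ ?_
  · exact (measurable_taylorKernel.comp
      (f := fun q : (Ω' × Ω × ℝ) × ℝ => (q.2, q.1.2.2)) (by fun_prop)).ennreal_ofReal
  · exact (measurable_curvature hV).comp
      (f := fun q : (Ω' × Ω × ℝ) × ℝ => (q.1.1, q.1.2.1, q.2)) (by fun_prop)

lemma measurable_nullPart [SFinite μ] {U U₁ : Ω' → Ω → ℝ → ℝ → ℝ}
    (hU : Measurable fun q : Ω' × Ω × ℝ × ℝ => U q.1 q.2.1 q.2.2.1 q.2.2.2)
    (hU₁ : Measurable fun q : Ω' × Ω × ℝ × ℝ => U₁ q.1 q.2.1 q.2.2.1 q.2.2.2)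
    (hV : Measurable fun q : Ω' × Ω × ℝ × ℝ => V q.1 q.2.1 q.2.2.1 q.2.2.2) :
    Measurable fun q : Ω' × Ω × ℝ => nullPart μ (U q.1) (U₁ q.1) (V q.1) q.2.1 q.2.2 := by
  unfold nullPart
  refine ((Measurable.sub ?_ ?_).sub (Measurable.mul ?_ measurable_snd.snd)).sub
    (measurable_convexPart hV).ennreal_toReal
  · exact hU.comp (g := fun q : Ω' × Ω × ℝ × ℝ => U q.1 q.2.1 q.2.2.1 q.2.2.2)
      (f := fun q : Ω' × Ω × ℝ => (q.1, q.2.1, q.2.2, (0 : ℝ))) (by fun_prop)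
  · exact hU.comp (g := fun q : Ω' × Ω × ℝ × ℝ => U q.1 q.2.1 q.2.2.1 q.2.2.2)
      (f := fun q : Ω' × Ω × ℝ => (q.1, q.2.1, (0 : ℝ), (0 : ℝ))) (by fun_prop)
  · exact hU₁.comp (g := fun q : Ω' × Ω × ℝ × ℝ => U₁ q.1 q.2.1 q.2.2.1 q.2.2.2)
      (f := fun q : Ω' × Ω × ℝ => (q.1, q.2.1, (0 : ℝ), (0 : ℝ))) (by fun_prop)

end Measurability

namespace DominatedFamily

variable {u u₁ u₂ : Ω → ℝ → ℝ → ℝ}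

lemma measurable_section (h : DominatedFamily μ u u₁ u₂) :
    Measurable fun q : Unit × Ω × ℝ × ℝ =>
      (fun _ => u₂ : Unit → Ω → ℝ → ℝ → ℝ) q.1 q.2.1 q.2.2.1 q.2.2.2 :=
  h.meas₂.comp measurable_snd

lemma measurable_curvature [SFinite μ] (h : DominatedFamily μ u u₁ u₂) :
    Measurable fun q : Ω × ℝ => curvature μ u₂ q.1 q.2 :=
  (NonLocal.measurable_curvature (V := fun _ : Unit => u₂) h.measurable_section).comp
    (f := fun q : Ω × ℝ => ((), q)) (by fun_prop)

lemma measurable_curvature_left [SFinite μ] (h : DominatedFamily μ u u₁ u₂) (t : ℝ) :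
    Measurable fun y => curvature μ u₂ y t :=
  h.measurable_curvature.comp (f := fun y : Ω => (y, t)) (by fun_prop)

lemma measurable_curvature_right [SFinite μ] (h : DominatedFamily μ u u₁ u₂) (y : Ω) :
    Measurable (curvature μ u₂ y) :=
  h.measurable_curvature.comp (f := fun t : ℝ => (y, t)) (by fun_prop)

lemma measurable_convexPart [SFinite μ] (h : DominatedFamily μ u u₁ u₂) (w : ℝ) :
    Measurable fun y => convexPart μ u₂ y w :=
  (NonLocal.measurable_convexPart (V := fun _ : Unit => u₂) h.measurable_section).comp
    (f := fun y => ((), y, w)) (by fun_prop)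

/-- By `lintegral_supGap_le` the truncated subtraction in `meanInf` is exact, so the mean restores
what the gap removes. -/
lemma lintegral_curvature [IsFiniteMeasure μ] [NeZero μ] (h : DominatedFamily μ u u₁ u₂) {w : ℝ}
    (hpos : ∀ (n : ℕ) (ψ : Ω → ℝ), Measurable ψ → (∀ y, |ψ y| ≤ n) →
      0 ≤ ∫ y, u₂ y w (ψ y) ∂μ) :
    ∫⁻ y, curvature μ u₂ y w ∂μ = ENNReal.ofReal (∫ y, u₂ y w 0 ∂μ) := by
  unfold curvature meanInf
  rw [lintegral_add_right _ measurable_const, lintegral_const,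
    ENNReal.div_mul_cancel (NeZero.ne _) (measure_ne_top _ _),
    add_tsub_cancel_of_le (h.lintegral_supGap_le hpos)]

/-- The remainder of the expansion of `u y w 0` at `w = 0`. -/
lemma integrable_remainder (h : DominatedFamily μ u u₁ u₂) (w : ℝ) :
    Integrable (fun y => u y w 0 - u y 0 0 - u₁ y 0 0 * w) μ := by
  have h0 := h.integrable (ψ := fun _ => 0) measurable_const (n := 0) (by simp)
  exact ((h0 w).1.sub (h0 0).1).sub ((h0 0).2.1.mul_const w)

/-- Tonelli and `lintegral_curvature` turn the left side into the Taylor remainder of `w ↦ ∫ u y w 0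
dy`, which is nonnegative since that function has nonnegative second derivative. -/
lemma lintegral_convexPart [IsFiniteMeasure μ] [NeZero μ] (h : DominatedFamily μ u u₁ u₂)
    (hpos : ∀ (w : ℝ) (n : ℕ) (ψ : Ω → ℝ), Measurable ψ → (∀ y, |ψ y| ≤ n) →
      0 ≤ ∫ y, u₂ y w (ψ y) ∂μ) (w : ℝ) :
    ∫⁻ y, convexPart μ u₂ y w ∂μ
        = ENNReal.ofReal (∫ y, (u y w 0 - u y 0 0 - u₁ y 0 0 * w) ∂μ) ∧
      0 ≤ ∫ y, (u y w 0 - u y 0 0 - u₁ y 0 0 * w) ∂μ := by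
  have h0 : ∀ y, |(fun _ : Ω => (0 : ℝ)) y| ≤ (0 : ℕ) := by simp
  have hm0 : Measurable fun _ : Ω => (0 : ℝ) := measurable_const
  have hi := h.integrable hm0 h0
  have hd := h.hasDerivAt_integral hm0 h0
  have hcont := h.continuous_integral hm0 h0
  have hT := integral_taylorKernel_mul (fun w => (hd w).1) (fun w => (hd w).2) hcont w
  have hTi := integrable_taylorKernel_mul hcont w
  have hnn : ∀ t, 0 ≤ taylorKernel t w * ∫ y, u₂ y t 0 ∂μ := fun t =>
    mul_nonneg (taylorKernel_nonneg t w) (hpos t 0 _ hm0 h0)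
  have heq : ∫ y, (u y w 0 - u y 0 0 - u₁ y 0 0 * w) ∂μ
      = ∫ t, taylorKernel t w * ∫ y, u₂ y t 0 ∂μ := by
    have hsub : Integrable (fun y => u y w 0 - u y 0 0) μ := (hi w).1.sub (hi 0).1
    rw [hT, integral_sub hsub ((hi 0).2.1.mul_const w),
      integral_sub (hi w).1 (hi 0).1, integral_mul_const]
  refine ⟨?_, heq ▸ integral_nonneg hnn⟩
  unfold convexPart
  have hmk : Measurable fun q : Ω × ℝ =>
      ENNReal.ofReal (taylorKernel q.2 w) * curvature μ u₂ q.1 q.2 :=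
    (measurable_taylorKernel.comp
      (f := fun q : Ω × ℝ => (q.2, w)) (by fun_prop)).ennreal_ofReal.mul h.measurable_curvature
  rw [lintegral_lintegral_swap hmk.aemeasurable, heq,
    ofReal_integral_eq_lintegral_ofReal hTi (Filter.Eventually.of_forall hnn)]
  refine lintegral_congr fun t => ?_
  rw [lintegral_const_mul _ (h.measurable_curvature_left t),
    h.lintegral_curvature (hpos t), ENNReal.ofReal_mul (taylorKernel_nonneg t w)]

/-- Finiteness is known almost everywhere for each single `w`; this makes countably many `w`
suffice. -/
lemma convexPart_ne_top_of_natCast {v : Ω → ℝ → ℝ → ℝ} {y : Ω}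
    (h : ∀ n : ℕ, convexPart μ v y n ≠ ∞ ∧ convexPart μ v y (-n) ≠ ∞)
    (hm : Measurable (curvature μ v y)) (w : ℝ) : convexPart μ v y w ≠ ∞ := by
  obtain ⟨n, hn⟩ := exists_nat_ge |w|
  refine ne_top_of_le_ne_top (ENNReal.add_ne_top.2 (h n)) ?_
  unfold convexPart
  have hmn : Measurable fun t : ℝ =>
      ENNReal.ofReal (taylorKernel t n) * curvature μ v y t :=
    (measurable_taylorKernel_left n).ennreal_ofReal.mul hm
  rw [← lintegral_add_left hmn]
  refine lintegral_mono fun t => ?_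
  rw [← add_mul, ← ENNReal.ofReal_add (taylorKernel_nonneg _ _) (taylorKernel_nonneg _ _)]
  gcongr
  exact taylorKernel_mono hn

lemma ae_convexPart_ne_top [IsFiniteMeasure μ] [NeZero μ] (h : DominatedFamily μ u u₁ u₂)
    (hpos : ∀ (w : ℝ) (n : ℕ) (ψ : Ω → ℝ), Measurable ψ → (∀ y, |ψ y| ≤ n) →
      0 ≤ ∫ y, u₂ y w (ψ y) ∂μ) : ∀ᵐ y ∂μ, ∀ w, convexPart μ u₂ y w ≠ ∞ := by
  have h1 : ∀ w, ∀ᵐ y ∂μ, convexPart μ u₂ y w ≠ ∞ := fun w => by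
    have := ae_lt_top (h.measurable_convexPart w)
      (by rw [(h.lintegral_convexPart hpos w).1]; exact ENNReal.ofReal_ne_top)
    filter_upwards [this] with y hy using hy.ne
  have h2 : ∀ᵐ y ∂μ, ∀ n : ℕ, convexPart μ u₂ y n ≠ ∞ ∧ convexPart μ u₂ y (-n) ≠ ∞ :=
    ae_all_iff.2 fun n => (h1 (n : ℝ)).and (h1 (-(n : ℝ)))
  filter_upwards [h2] with y hy
  exact convexPart_ne_top_of_natCast hy (h.measurable_curvature_right y)

lemma integral_nullPart [IsFiniteMeasure μ] [NeZero μ] (h : DominatedFamily μ u u₁ u₂)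
    (hpos : ∀ (w : ℝ) (n : ℕ) (ψ : Ω → ℝ), Measurable ψ → (∀ y, |ψ y| ≤ n) →
      0 ≤ ∫ y, u₂ y w (ψ y) ∂μ) (w : ℝ) :
    ∫ y, nullPart μ u u₁ u₂ y w ∂μ = 0 := by
  obtain ⟨h1, h2⟩ := h.lintegral_convexPart hpos w
  have hne : ∫⁻ y, convexPart μ u₂ y w ∂μ ≠ ∞ := by rw [h1]; exact ENNReal.ofReal_ne_top
  have hm := (h.measurable_convexPart w).aemeasurable (μ := μ)
  unfold nullPart
  rw [integral_sub (h.integrable_remainder w) (integrable_toReal_of_lintegral_ne_top hm hne),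
    integral_toReal hm (ae_lt_top' hm hne), h1, ENNReal.toReal_ofReal h2, sub_self]

/-- The convex part has the same integral as the remainder, so each of the two contributes at most
the `L¹` norm of the remainder. -/
lemma lintegral_nullPart_le [IsFiniteMeasure μ] [NeZero μ] (h : DominatedFamily μ u u₁ u₂)
    (hpos : ∀ (w : ℝ) (n : ℕ) (ψ : Ω → ℝ), Measurable ψ → (∀ y, |ψ y| ≤ n) →
      0 ≤ ∫ y, u₂ y w (ψ y) ∂μ) (w : ℝ) :
    ∫⁻ y, ENNReal.ofReal |nullPart μ u u₁ u₂ y w| ∂μ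
      ≤ 2 * ∫⁻ y, ENNReal.ofReal |u y w 0 - u y 0 0 - u₁ y 0 0 * w| ∂μ := by
  obtain ⟨h1, h2⟩ := h.lintegral_convexPart hpos w
  have hi := h.integrable_remainder w
  have hle : ∫⁻ y, convexPart μ u₂ y w ∂μ
      ≤ ∫⁻ y, ENNReal.ofReal |u y w 0 - u y 0 0 - u₁ y 0 0 * w| ∂μ := by
    rw [h1, ← ofReal_integral_eq_lintegral_ofReal hi.abs
      (Filter.Eventually.of_forall fun y => abs_nonneg _)]
    exact ENNReal.ofReal_le_ofReal (integral_mono hi hi.abs fun y => le_abs_self _)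
  rw [two_mul]
  refine le_trans ?_ (add_le_add_right hle _)
  rw [← lintegral_add_right _ (h.measurable_convexPart w)]
  refine lintegral_mono fun y => ?_
  unfold nullPart
  refine (ENNReal.ofReal_le_ofReal (abs_sub _ _)).trans ?_
  rw [ENNReal.ofReal_add (abs_nonneg _) (abs_nonneg _), abs_of_nonneg ENNReal.toReal_nonneg]
  gcongr
  exact ENNReal.ofReal_toReal_le

/-- By Taylor's formula at `z` and at `0`, the difference is affine in `w` plus the kernel
integrated against `u₂ y t z - u₂ y t 0 + K t`, and this weight is nonnegative because `K` dominates
the gap. -/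
lemma convexOn_sub_nullPart [SFinite μ] (h : DominatedFamily μ u u₁ u₂) {y : Ω}
    (hfin : ∀ w, convexPart μ u₂ y w ≠ ∞) (z : ℝ) :
    ConvexOn ℝ univ fun w => u y w z - nullPart μ u u₁ u₂ y w := by
  have hmi : ∀ w, Measurable fun t =>
      ENNReal.ofReal (taylorKernel t w) * curvature μ u₂ y t := fun w =>
    (measurable_taylorKernel_left w).ennreal_ofReal.mul (h.measurable_curvature_right y)
  let K : ℝ → ℝ := fun t => (curvature μ u₂ y t).toReal
  have hmul : ∀ t w, (ENNReal.ofReal (taylorKernel t w) * curvature μ u₂ y t).toReal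
      = taylorKernel t w * K t := fun t w => by
    rw [ENNReal.toReal_mul, ENNReal.toReal_ofReal (taylorKernel_nonneg t w)]
  have hKi : ∀ w, Integrable fun t => taylorKernel t w * K t := fun w => by
    simp_rw [← hmul]
    exact integrable_toReal_of_lintegral_ne_top (hmi w).aemeasurable (hfin w)
  have hKint : ∀ w, (convexPart μ u₂ y w).toReal = ∫ t, taylorKernel t w * K t := fun w => by
    simp_rw [← hmul]
    exact (integral_toReal (hmi w).aemeasurable (ae_lt_top (hmi w) (hfin w))).symm
  -- `toReal` sends `∞` to `0`, so `K` dominates the gap only where the curvature is finite.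
  have hcfin : ∀ᵐ t : ℝ, t ≠ 0 → curvature μ u₂ y t ≠ ∞ := by
    have : ∀ᵐ t : ℝ, ∀ n : ℤ,
        ENNReal.ofReal (taylorKernel t n) * curvature μ u₂ y t < ∞ :=
      ae_all_iff.2 fun n => ae_lt_top (hmi (n : ℝ)) (hfin (n : ℝ))
    filter_upwards [this] with t ht h0 htop
    obtain ⟨n, hn⟩ : ∃ n : ℤ, 0 < taylorKernel t n := by
      unfold taylorKernel
      rcases lt_or_gt_of_ne h0 with h0 | h0
      · obtain ⟨n, hn⟩ := exists_int_lt t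
        exact ⟨n, by rw [if_neg (by linarith)]; exact lt_max_of_lt_left (by linarith)⟩
      · obtain ⟨n, hn⟩ := exists_int_gt t
        exact ⟨n, by rw [if_pos h0]; exact lt_max_of_lt_left (by linarith)⟩
    have := ht n
    rw [htop, ENNReal.mul_top (ENNReal.ofReal_pos.2 hn).ne'] at this
    exact lt_irrefl _ this
  have hc2 : ∀ z, Continuous fun t => u₂ y t z := fun z =>
    (h.cont y).comp (continuous_id.prodMk continuous_const)
  have hTi := fun z w => integrable_taylorKernel_mul (hc2 z) w
  have hT := fun z w => integral_taylorKernel_mul (fun t => h.deriv₁ y t z)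
    (fun t => h.deriv₂ y t z) (hc2 z) w
  have hpos : ∀ᵐ t : ℝ, 0 ≤ u₂ y t z - u₂ y t 0 + K t := by
    filter_upwards [hcfin, Measure.ae_ne volume (0 : ℝ)] with t ht h0
    have h1 : ENNReal.ofReal (u₂ y t 0 - u₂ y t z) ≤ curvature μ u₂ y t :=
      (le_supGap ((h.cont y).comp (continuous_const.prodMk continuous_id)) z).trans le_self_add
    have := (ENNReal.ofReal_le_iff_le_toReal (ht h0)).1 h1
    simp only [K]
    linarith
  have hexp : ∀ t w, taylorKernel t w * (u₂ y t z - u₂ y t 0 + K t)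
      = taylorKernel t w * u₂ y t z - taylorKernel t w * u₂ y t 0 + taylorKernel t w * K t :=
    fun t w => by ring
  have hconv := convexOn_integral_taylorKernel hpos fun w => by
    simp_rw [hexp]
    exact ((hTi z w).sub (hTi 0 w)).add (hKi w)
  have haff : ConvexOn ℝ univ fun w : ℝ => u₁ y 0 z * w + u y 0 z := by
    refine ⟨convex_univ, fun v _ w _ a b _ _ hab => le_of_eq ?_⟩
    simp only [smul_eq_mul]
    linear_combination (-(u y 0 z)) * hab
  refine (hconv.add haff).congr fun w _ => ?_
  simp only [Pi.add_apply, hexp, nullPart, hKint]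
  have hsub : Integrable fun t => taylorKernel t w * u₂ y t z - taylorKernel t w * u₂ y t 0 :=
    (hTi z w).sub (hTi 0 w)
  rw [integral_add hsub (hKi w), integral_sub (hTi z w) (hTi 0 w), hT, hT]
  ring

end DominatedFamily

end Generic

/-! ### Partial derivatives -/

lemma measurable_of_hasDerivAt {β : Type*} [MeasurableSpace β] {v v' : β → ℝ → ℝ}
    (hv : Measurable fun q : β × ℝ => v q.1 q.2) (h : ∀ b t, HasDerivAt (v b) (v' b t) t) :
    Measurable fun q : β × ℝ => v' q.1 q.2 := by
  have hlim : Filter.Tendsto (fun n : ℕ => 1 / ((n : ℝ) + 1)) Filter.atTop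
      (nhdsWithin 0 {0}ᶜ) :=
    tendsto_nhdsWithin_iff.2 ⟨tendsto_one_div_add_atTop_nhds_zero_nat,
      Filter.Eventually.of_forall fun n => by
        simp only [mem_compl_iff, mem_singleton_iff]; positivity⟩
  refine measurable_of_tendsto_metrizable
    (f := fun (n : ℕ) (q : β × ℝ) => (1 / ((n : ℝ) + 1))⁻¹ •
      (v q.1 (q.2 + 1 / ((n : ℝ) + 1)) - v q.1 q.2)) (fun n => ?_) ?_
  · have h1 : Measurable fun q : β × ℝ => v q.1 (q.2 + 1 / ((n : ℝ) + 1)) :=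
      hv.comp (f := fun q : β × ℝ => (q.1, q.2 + 1 / ((n : ℝ) + 1))) (by fun_prop)
    exact (h1.sub hv).const_smul ((1 / ((n : ℝ) + 1))⁻¹)
  · rw [tendsto_pi_nhds]
    exact fun q => ((h q.1 q.2).tendsto_slope_zero).comp hlim

lemma measurable_of_hasDerivAt_third {Ω : Type*} [MeasurableSpace Ω] {v v' : Ω → Ω → ℝ → ℝ → ℝ}
    (hv : Measurable fun q : Ω × Ω × ℝ × ℝ => v q.1 q.2.1 q.2.2.1 q.2.2.2)
    (h : ∀ x y w z, HasDerivAt (fun t => v x y t z) (v' x y w z) w) :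
    Measurable fun q : Ω × Ω × ℝ × ℝ => v' q.1 q.2.1 q.2.2.1 q.2.2.2 := by
  have := measurable_of_hasDerivAt (β := Ω × Ω × ℝ) (v := fun b t => v b.1 b.2.1 t b.2.2)
    (v' := fun b t => v' b.1 b.2.1 t b.2.2)
    (hv.comp (f := fun q : (Ω × Ω × ℝ) × ℝ => (q.1.1, q.1.2.1, q.2, q.1.2.2)) (by fun_prop))
    fun b t => h _ _ _ _
  exact this.comp (f := fun q : Ω × Ω × ℝ × ℝ => ((q.1, q.2.1, q.2.2.2), q.2.2.1)) (by fun_prop)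

lemma contDiff_partial {G : ℝ → ℝ → ℝ} {n : WithTop ℕ∞}
    (hG : ContDiff ℝ (n + 1) fun q : ℝ × ℝ => G q.1 q.2) :
    ContDiff ℝ n (fun q : ℝ × ℝ => deriv (fun t => G t q.2) q.1) ∧
      ∀ w z, HasDerivAt (fun t => G t z) (deriv (fun t => G t z) w) w := by
  have hd : Differentiable ℝ fun q : ℝ × ℝ => G q.1 q.2 := hG.differentiable (by simp)
  have h1 : ∀ w z, HasDerivAt (fun t => G t z)
      (fderiv ℝ (fun q : ℝ × ℝ => G q.1 q.2) (w, z) (1, 0)) w := fun w z =>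
    (hd (w, z)).hasFDerivAt.comp_hasDerivAt (f := fun t : ℝ => (t, z)) w
      ((hasDerivAt_id w).prodMk (hasDerivAt_const w z))
  refine ⟨?_, fun w z => (h1 w z).differentiableAt.hasDerivAt⟩
  have h2 : (fun q : ℝ × ℝ => deriv (fun t => G t q.2) q.1)
      = fun q => fderiv ℝ (fun q : ℝ × ℝ => G q.1 q.2) q (1, 0) :=
    funext fun q => (h1 q.1 q.2).deriv
  rw [h2]
  exact (hG.fderiv_right le_rfl).clm_apply contDiff_const

lemma iteratedDeriv_two (v : ℝ → ℝ) (w : ℝ) : iteratedDeriv 2 v w = deriv (deriv v) w := by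
  rw [iteratedDeriv_succ, iteratedDeriv_one]

/-! ### Growth -/

/-- The weight `|w|^(p-1)`, or `0` if `p = ∞`. -/
noncomputable def derivWeight (p : ℝ≥0∞) (w : ℝ) : ℝ := if p = ∞ then 0 else |w| ^ (p.toReal - 1)

/-- The weight `|w|^p`, or `0` if `p = ∞`. -/
noncomputable def powWeight (p : ℝ≥0∞) (w : ℝ) : ℝ := if p = ∞ then 0 else |w| ^ p.toReal

lemma derivWeight_nonneg (p : ℝ≥0∞) (w : ℝ) : 0 ≤ derivWeight p w := by
  unfold derivWeight; split_ifs <;> positivity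

lemma powWeight_nonneg (p : ℝ≥0∞) (w : ℝ) : 0 ≤ powWeight p w := by
  unfold powWeight; split_ifs <;> positivity

lemma derivWeight_mono {p : ℝ≥0∞} (hp : 1 ≤ p) {v w : ℝ} (h : |v| ≤ |w|) :
    derivWeight p v ≤ derivWeight p w := by
  unfold derivWeight
  split_ifs with hpt
  · exact le_rfl
  · have : (1 : ℝ) ≤ p.toReal := by simpa using ENNReal.toReal_mono hpt hp
    exact Real.rpow_le_rpow (abs_nonneg v) h (by linarith)

lemma abs_mul_derivWeight {p : ℝ≥0∞} (hp : 1 ≤ p) (w : ℝ) :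
    |w| * derivWeight p w = powWeight p w := by
  unfold derivWeight powWeight
  split_ifs with hpt
  · exact mul_zero _
  · have h1 : (1 : ℝ) ≤ p.toReal := by simpa using ENNReal.toReal_mono hpt hp
    rcases eq_or_lt_of_le (abs_nonneg w) with h | h
    · rw [← h, zero_mul, Real.zero_rpow (by linarith)]
    · rw [Real.rpow_sub_one h.ne']
      field_simp

lemma pp_eq_ofReal_powWeight {p : ℝ≥0∞} {M w : ℝ} (h : p = ∞ → |w| ≤ M) :
    pp p M w = ENNReal.ofReal (powWeight p w) := by
  unfold pp powWeight
  split_ifs with h1 h2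
  · simp
  · exact absurd (h h1) h2
  · rfl

lemma pp_eq_top {M w : ℝ} (h : M < |w|) : pp ∞ M w = ∞ := by
  simp [pp, h]

lemma pp_sub_one {p : ℝ≥0∞} {M w : ℝ} (hp : 1 ≤ p) (h : p = ∞ → |w| ≤ M) :
    pp (p - 1) M w = ENNReal.ofReal (derivWeight p w) := by
  by_cases hpt : p = ∞
  · subst hpt
    simp [pp, derivWeight, h rfl]
  · have h1 : p - 1 ≠ ∞ := ENNReal.sub_ne_top hpt
    simp [pp, derivWeight, h1, hpt, ENNReal.toReal_sub_of_le hp hpt]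

section Generic

variable {Ω : Type*} [MeasurableSpace Ω] {μ : Measure Ω}

/-- Young's inequality for `1 < p < ∞`. For `p = 1` the function `u` is essentially bounded; for `p
= ∞` the bound `|w| ≤ M` is inserted. -/
lemma exists_young_bound [IsFiniteMeasure μ] {p : ℝ≥0∞} (hp : 1 ≤ p) {u : Ω → ℝ}
    (hu : MemLp u (ENNReal.conjExponent p) μ) (M : ℝ) :
    ∃ (a : Ω → ℝ) (C : ℝ), Integrable a μ ∧ 0 ≤ C ∧ ∀ᵐ x ∂μ, ∀ w : ℝ, (p = ∞ → |w| ≤ M) →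
      |u x| * |w| ≤ a x + C * powWeight p w := by
  have hconj : 1 ≤ ENNReal.conjExponent p := by simp [ENNReal.conjExponent]
  by_cases hpt : p = ∞
  · refine ⟨fun x => |u x| * M, 0, (hu.integrable hconj).abs.mul_const M, le_rfl,
      Filter.Eventually.of_forall fun x w hw => ?_⟩
    have := mul_le_mul_of_nonneg_left (hw hpt) (abs_nonneg (u x))
    linarith
  rcases eq_or_lt_of_le hp with rfl | hp1
  · have h1 : ENNReal.conjExponent 1 = ∞ := by simp [ENNReal.conjExponent]
    rw [h1] at hu
    refine ⟨0, (eLpNormEssSup u μ).toReal, integrable_zero _ _ _, ENNReal.toReal_nonneg, ?_⟩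
    filter_upwards [ae_le_eLpNormEssSup (f := u) (μ := μ)] with x hx w _
    have hfin : eLpNormEssSup u μ ≠ ∞ := by
      have := hu.2
      rw [eLpNorm_exponent_top] at this
      exact this.ne
    have h2 := ENNReal.toReal_mono hfin hx
    rw [toReal_enorm, Real.norm_eq_abs] at h2
    have h3 : powWeight 1 w = |w| := by simp [powWeight]
    rw [h3]
    simpa using mul_le_mul_of_nonneg_right h2 (abs_nonneg w)
  · have hc : p.HolderConjugate (ENNReal.conjExponent p) := ENNReal.HolderConjugate.conjExponent hp
    have hqt : ENNReal.conjExponent p ≠ ∞ := by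
      simp [ENNReal.conjExponent, tsub_eq_zero_iff_le, hp1]
    have hp1' : 1 < p.toReal := by
      simpa using (ENNReal.toReal_lt_toReal ENNReal.one_ne_top hpt).2 hp1
    have hr : p.toReal.HolderConjugate (ENNReal.conjExponent p).toReal :=
      (ENNReal.HolderConjugate.toReal_iff hp1').2 hc
    refine ⟨fun x => ‖u x‖ ^ (ENNReal.conjExponent p).toReal, 1,
      hu.integrable_norm_rpow (by positivity) hqt, zero_le_one,
      Filter.Eventually.of_forall fun x w _ => ?_⟩
    have := Real.young_inequality_of_nonneg (abs_nonneg (u x)) (abs_nonneg w) hr.symm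
    refine this.trans ?_
    simp only [powWeight, if_neg hpt, one_mul, Real.norm_eq_abs]
    exact add_le_add (div_le_self (by positivity) hr.symm.lt.le)
      (div_le_self (by positivity) hr.lt.le)

/-! ### Domination and growth of the integrand -/

/-- The hypotheses on the integrand, over a general measure space. -/
structure IsRegular (p : ℝ≥0∞) (μ : Measure Ω) (f : Ω → Ω → ℝ → ℝ → ℝ) : Prop where
  symm : ∀ x y w z, f x y w z = f y x z w
  meas : Measurable fun q : Ω × Ω × ℝ × ℝ => f q.1 q.2.1 q.2.2.1 q.2.2.2
  base : Integrable (fun s : Ω × Ω => f s.1 s.2 0 0) (μ.prod μ)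
  diff : ∀ᵐ s ∂μ.prod μ, ContDiff ℝ 2 fun q : ℝ × ℝ => f s.1 s.2 q.1 q.2
  bound : ∀ M : ℝ, 0 < M → ∃ (k : ℕ) (u v : Fin k → Ω → ℝ) (b : Ω → ℝ),
    (∀ i, MemLp (u i) (ENNReal.conjExponent p) μ) ∧ (∀ i, Integrable (v i) μ) ∧
    Integrable b μ ∧ (∀ y, 0 ≤ b y) ∧
    ∀ᵐ s ∂μ.prod μ, ∀ w z : ℝ, |z| ≤ M → (p = ∞ → |w| ≤ M) →
      |deriv (fun t => f s.1 s.2 t z) w| ≤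
        ∑ i, |u i s.1| * |v i s.2| + b s.2 * derivWeight p w
  bound₂ : ∀ M : ℝ, 0 < M → ∃ A : Ω × Ω → ℝ, Integrable A (μ.prod μ) ∧
    ∀ᵐ s ∂μ.prod μ, ∀ w z : ℝ, |w| ≤ M → |z| ≤ M →
      |iteratedDeriv 2 (fun t => f s.1 s.2 t z) w| ≤ A s

lemma ae_swap [SFinite μ] {P : Ω × Ω → Prop} (h : ∀ᵐ s ∂μ.prod μ, P s) :
    ∀ᵐ s ∂μ.prod μ, P s.swap :=
  Measure.measurePreserving_swap.quasiMeasurePreserving.ae h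

lemma abs_sub_le_of_abs_deriv_le {v : ℝ → ℝ} (hv : Differentiable ℝ v) {w B : ℝ}
    (hB : ∀ t, |t| ≤ |w| → |deriv v t| ≤ B) : |v w - v 0| ≤ B * |w| := by
  have := (convex_Icc (-|w|) |w|).norm_image_sub_le_of_norm_deriv_le (f := v) (C := B) (x := 0)
    (y := w) (fun t _ => hv t) (fun t ht => hB t (abs_le.2 ht))
    (mem_Icc.2 ⟨by simp, abs_nonneg w⟩)
    (mem_Icc.2 (abs_le.1 le_rfl))
  simpa using this

lemma integrable_powWeight_comp {p : ℝ≥0∞} (hp : 1 ≤ p) {ψ : Ω → ℝ} (hψ : MemLp ψ p μ) :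
    Integrable (fun y => powWeight p (ψ y)) μ := by
  unfold powWeight
  split_ifs with h
  · exact integrable_zero _ _ _
  · exact hψ.integrable_norm_rpow (zero_lt_one.trans_le hp).ne' h

namespace IsRegular

variable {p : ℝ≥0∞} {f : Ω → Ω → ℝ → ℝ → ℝ}

lemma differentiable {G : ℝ → ℝ → ℝ} (hG : ContDiff ℝ 2 fun q : ℝ × ℝ => G q.1 q.2) (z : ℝ) :
    Differentiable ℝ fun t => G t z :=
  (hG.comp (contDiff_id.prodMk contDiff_const)).differentiable (by simp)

lemma increment_le (hp : 1 ≤ p) {G : ℝ → ℝ → ℝ} (hG : ContDiff ℝ 2 fun q : ℝ × ℝ => G q.1 q.2)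
    {M a b : ℝ} (hb : 0 ≤ b) (h : ∀ w z : ℝ, |z| ≤ M → (p = ∞ → |w| ≤ M) →
      |deriv (fun t => G t z) w| ≤ a + b * derivWeight p w) {w z : ℝ} (hz : |z| ≤ M)
    (hw : p = ∞ → |w| ≤ M) : |G w z - G 0 z| ≤ a * |w| + b * powWeight p w := by
  rw [← abs_mul_derivWeight hp]
  refine (abs_sub_le_of_abs_deriv_le (B := a + b * derivWeight p w) (differentiable hG z)
    fun t ht => ?_).trans_eq (by ring)
  refine (h t z hz fun hpt => ht.trans (hw hpt)).trans ?_
  gcongr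
  exact derivWeight_mono hp ht

lemma integrable_sum [IsFiniteMeasure μ] {k : ℕ} {u v : Fin k → Ω → ℝ}
    (hu : ∀ i, Integrable (u i) μ) (hv : ∀ i, Integrable (v i) μ) :
    Integrable (fun s : Ω × Ω => ∑ i, |u i s.1| * |v i s.2|) (μ.prod μ) :=
  integrable_finsetSum _ fun i _ => (hu i).abs.mul_prod (hv i).abs

/-- The value at `(w,z)` is reached from `(0,0)` through `(0,z)`; pairwise symmetry turns the
increment in `z` into one in the first real variable at the swapped point. -/
lemma exists_dominating [IsFiniteMeasure μ] (hf : IsRegular p μ f) (hp : 1 ≤ p) (n : ℕ) :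
    ∃ A : Ω × Ω → ℝ, Integrable A (μ.prod μ) ∧ ∀ᵐ s ∂μ.prod μ, ∀ w z : ℝ, |w| ≤ n → |z| ≤ n →
      |f s.1 s.2 w z| ≤ A s ∧ |deriv (fun t => f s.1 s.2 t z) w| ≤ A s ∧
        |iteratedDeriv 2 (fun t => f s.1 s.2 t z) w| ≤ A s := by
  have hconj : 1 ≤ ENNReal.conjExponent p := by simp [ENNReal.conjExponent]
  let M : ℝ := n + 1
  have hM : 0 < M := by positivity
  have hnM : (n : ℝ) ≤ M := by simp [M]
  obtain ⟨k, u, v, b, hu, hv, hb, hb0, hbd⟩ := hf.bound M hM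
  obtain ⟨A₂, hA₂, hbd₂⟩ := hf.bound₂ M hM
  let a : Ω × Ω → ℝ := fun s => ∑ i, |u i s.1| * |v i s.2|
  have ha : Integrable a (μ.prod μ) := integrable_sum (fun i => (hu i).integrable hconj) hv
  have ha0 : ∀ s, 0 ≤ a s := fun s => Finset.sum_nonneg fun i _ => by positivity
  have hb1 : Integrable (fun s : Ω × Ω => b s.1) (μ.prod μ) := hb.comp_fst μ
  have hb2 : Integrable (fun s : Ω × Ω => b s.2) (μ.prod μ) := hb.comp_snd μ
  let P : ℝ := M * derivWeight p M
  have hW := derivWeight_nonneg p M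
  refine ⟨fun s => |f s.1 s.2 0 0| + (M * a s + P * b s.2) + (M * a s.swap + P * b s.1)
    + (a s + derivWeight p M * b s.2) + |A₂ s|,
    ((((hf.base.abs.add ((ha.const_mul _).add (hb2.const_mul _))).add
      ((ha.swap.const_mul _).add (hb1.const_mul _))).add (ha.add (hb2.const_mul _))).add
      hA₂.abs), ?_⟩
  filter_upwards [hf.diff, ae_swap hf.diff, hbd, ae_swap hbd, hbd₂] with s hd hd' h1 h1' h2 w z hw hz
  have hwM : |w| ≤ M := hw.trans hnM
  have hzM : |z| ≤ M := hz.trans hnM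
  have hmono : ∀ t : ℝ, |t| ≤ M → derivWeight p t ≤ derivWeight p M := fun t ht =>
    derivWeight_mono hp (by rwa [abs_of_pos hM])
  have hpow : ∀ t : ℝ, |t| ≤ M → powWeight p t ≤ P := fun t ht => by
    rw [← abs_mul_derivWeight hp]
    exact mul_le_mul ht (hmono t ht) (derivWeight_nonneg _ _) hM.le
  have i1 := increment_le hp hd (hb0 s.2) h1 hzM fun _ => hwM
  have i2 := increment_le hp hd' (hb0 s.1) h1' (w := z) (z := 0) (by simpa using hM.le)
    fun _ => hzM
  simp only [Prod.fst_swap, Prod.snd_swap] at i2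
  rw [hf.symm s.2 s.1 z 0, hf.symm s.2 s.1 0 0] at i2
  have e1 : a s * |w| + b s.2 * powWeight p w ≤ M * a s + P * b s.2 := by
    have := mul_le_mul_of_nonneg_left hwM (ha0 s)
    have := mul_le_mul_of_nonneg_left (hpow w hwM) (hb0 s.2)
    linarith
  have e2 : a s.swap * |z| + b s.1 * powWeight p z ≤ M * a s.swap + P * b s.1 := by
    have := mul_le_mul_of_nonneg_left hzM (ha0 s.swap)
    have := mul_le_mul_of_nonneg_left (hpow z hzM) (hb0 s.1)
    linarith
  have e3 : |deriv (fun t => f s.1 s.2 t z) w| ≤ a s + derivWeight p M * b s.2 := by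
    have := mul_le_mul_of_nonneg_left (hmono w hwM) (hb0 s.2)
    have := h1 w z hzM fun _ => hwM
    linarith
  have e4 := (h2 w z hwM hzM).trans (le_abs_self (A₂ s))
  have i1' := i1.trans e1
  have i2' := i2.trans e2
  have p1 := (abs_nonneg _).trans i1'
  have p2 := (abs_nonneg _).trans i2'
  have p3 := (abs_nonneg _).trans e3
  have p4 := abs_nonneg (A₂ s)
  have p5 := abs_nonneg (f s.1 s.2 0 0)
  have t1 : |f s.1 s.2 w z| ≤ |f s.1 s.2 0 0| + |f s.1 s.2 w z - f s.1 s.2 0 z|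
      + |f s.1 s.2 0 z - f s.1 s.2 0 0| := by
    have e : f s.1 s.2 w z = f s.1 s.2 0 0 + (f s.1 s.2 w z - f s.1 s.2 0 z)
      + (f s.1 s.2 0 z - f s.1 s.2 0 0) := by ring
    calc |f s.1 s.2 w z| = _ := congrArg abs e
      _ ≤ _ := abs_add_three _ _ _
  refine ⟨?_, ?_, ?_⟩ <;> linarith

/-- By symmetry the increment from `0` to `ψ(y)` in the last variable is bounded by terms `|v(x)|
|u(y)| |ψ(y)|`, integrable by Hölder, and `b(x) |ψ(y)|^p` (absent for `p = ∞`). -/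
lemma ae_integrable [IsFiniteMeasure μ] (hf : IsRegular p μ f) (hp : 1 ≤ p) {ψ : Ω → ℝ}
    (hψm : Measurable ψ) (hψ : MemLp ψ p μ) :
    ∀ᵐ x ∂μ, ∀ w, Integrable (fun y => f x y w (ψ y)) μ := by
  have hc : p.HolderConjugate (ENNReal.conjExponent p) := ENNReal.HolderConjugate.conjExponent hp
  obtain ⟨n₀, hn₀⟩ : ∃ n₀ : ℕ, p = ∞ → ∀ᵐ y ∂μ, |ψ y| ≤ n₀ := by
    by_cases hpt : p = ∞
    · subst hpt
      obtain ⟨n₀, h⟩ := exists_nat_ge (eLpNormEssSup ψ μ).toReal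
      refine ⟨n₀, fun _ => ?_⟩
      have hfin : eLpNormEssSup ψ μ ≠ ∞ := by
        have := hψ.2
        rw [eLpNorm_exponent_top] at this
        exact this.ne
      filter_upwards [ae_le_eLpNormEssSup (f := ψ) (μ := μ)] with y hy
      have h2 := ENNReal.toReal_mono hfin hy
      rw [toReal_enorm, Real.norm_eq_abs] at h2
      exact h2.trans h
    · exact ⟨0, fun h => absurd h hpt⟩
  have key : ∀ n : ℕ, ∃ B : Ω × Ω → ℝ, Integrable B (μ.prod μ) ∧
      ∀ᵐ s ∂μ.prod μ, ∀ w : ℝ, |w| ≤ n → |f s.1 s.2 w (ψ s.2)| ≤ B s := by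
    intro n
    let M : ℝ := n + n₀ + 1
    have hM : 0 < M := by positivity
    obtain ⟨A, hA, hAb⟩ := hf.exists_dominating hp n
    obtain ⟨k, u, v, b, hu, hv, hb, hb0, hbd⟩ := hf.bound M hM
    have huψ : ∀ i, Integrable (fun y => |u i y| * |ψ y|) μ := fun i => by
      have := ((hu i).norm.integrable_mul hψ.norm)
      exact this
    refine ⟨fun s => A s + ((∑ i, |v i s.1| * (|u i s.2| * |ψ s.2|)) + b s.1 * powWeight p (ψ s.2)),
      hA.add ((integrable_finsetSum _ fun i _ => (hv i).abs.mul_prod (huψ i)).add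
        (hb.mul_prod (integrable_powWeight_comp hp hψ))), ?_⟩
    have hψb : ∀ᵐ s ∂μ.prod μ, p = ∞ → |ψ s.2| ≤ n₀ := by
      by_cases hpt : p = ∞
      · have := Measure.quasiMeasurePreserving_snd (μ := μ) (ν := μ) |>.ae (hn₀ hpt)
        filter_upwards [this] with s hs _ using hs
      · exact Filter.Eventually.of_forall fun s h => absurd h hpt
    filter_upwards [ae_swap hf.diff, ae_swap hbd, hAb, hψb] with s hd h1 h2 h3 w hw
    have i1 := increment_le hp hd (hb0 s.1) h1 (w := ψ s.2) (z := w)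
      (hw.trans (by simp only [M]; have : (0 : ℝ) ≤ n₀ := n₀.cast_nonneg; linarith))
      fun hpt => (h3 hpt).trans
        (by simp only [M]; have : (0 : ℝ) ≤ n := n.cast_nonneg; linarith)
    simp only [Prod.fst_swap, Prod.snd_swap] at i1
    rw [hf.symm s.2 s.1 _ w, hf.symm s.2 s.1 0 w] at i1
    have i2 := (h2 w 0 hw (by simp)).1
    have t : |f s.1 s.2 w (ψ s.2)| ≤ |f s.1 s.2 w 0| + |f s.1 s.2 w (ψ s.2) - f s.1 s.2 w 0| := by
      simpa using abs_add_le (f s.1 s.2 w 0) (f s.1 s.2 w (ψ s.2) - f s.1 s.2 w 0)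
    have e : (∑ i, |u i s.2| * |v i s.1|) * |ψ s.2|
        = ∑ i, |v i s.1| * (|u i s.2| * |ψ s.2|) := by
      rw [Finset.sum_mul]
      exact Finset.sum_congr rfl fun i _ => by ring
    rw [e] at i1
    linarith
  choose B hB hBb using key
  have h1 : ∀ᵐ x ∂μ, ∀ n, Integrable (fun y => B n (x, y)) μ :=
    ae_all_iff.2 fun n => (hB n).prod_right_ae
  have h2 : ∀ᵐ x ∂μ, ∀ n : ℕ, ∀ᵐ y ∂μ, ∀ w : ℝ, |w| ≤ n → |f x y w (ψ y)| ≤ B n (x, y) :=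
    ae_all_iff.2 fun n => Measure.ae_ae_of_ae_prod (hBb n)
  filter_upwards [h1, h2] with x hx1 hx2 w
  obtain ⟨n, hn⟩ := exists_nat_ge |w|
  refine (hx1 n).mono' ?_ ?_
  · exact (hf.meas.comp (f := fun y => (x, y, w, ψ y)) (by fun_prop)).aestronglyMeasurable
  · filter_upwards [hx2 n] with y hy using hy w hn

/-- The growth in `w` of the remainder of the first order expansion at `w = 0`. -/
lemma remainder_growth [IsFiniteMeasure μ] (hf : IsRegular p μ f) (hp : 1 ≤ p) {M : ℝ} (hM : 0 < M) :
    ∃ (a : Ω → ℝ) (C : ℝ), Integrable a μ ∧ 0 < C ∧ ∀ᵐ x ∂μ, ∀ w : ℝ,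
      2 * ∫⁻ y, ENNReal.ofReal
        |f x y w 0 - f x y 0 0 - deriv (fun t => f x y t 0) 0 * w| ∂μ ≤
        ENNReal.ofReal (a x) + ENNReal.ofReal C * pp p M w := by
  obtain ⟨k, u, v, b, hu, hv, hb, hb0, hbd⟩ := hf.bound M hM
  choose a C ha hC hYoung using fun i => exists_young_bound hp (hu i) M
  let V : Fin k → ℝ := fun i => ∫ y, |v i y| ∂μ
  have hV : ∀ i, 0 ≤ V i := fun i => integral_nonneg fun y => abs_nonneg _
  have hB : 0 ≤ ∫ y, b y ∂μ := integral_nonneg hb0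
  have hCV : 0 ≤ ∑ i, C i * V i := Finset.sum_nonneg fun i _ => mul_nonneg (hC i) (hV i)
  -- One factor `2` is in the statement; the other arises because the increment and the linear term
  -- obey the same bound. The `+ 1` makes the constant positive.
  refine ⟨fun x => 4 * ∑ i, a i x * V i, 4 * (∑ i, C i * V i + ∫ y, b y ∂μ) + 1,
    (integrable_finsetSum _ fun i _ => (ha i).mul_const _).const_mul 4, by positivity, ?_⟩
  filter_upwards [Measure.ae_ae_of_ae_prod hf.diff, Measure.ae_ae_of_ae_prod hbd,
    ae_all_iff.2 hYoung] with x hd h1 hY w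
  by_cases hw : p = ∞ → |w| ≤ M
  swap
  · push Not at hw
    rw [hw.1, pp_eq_top hw.2, ENNReal.mul_top (by positivity), add_top]
    exact le_top
  have hint : Integrable (fun y => 2 * ((∑ i, |u i x| * |v i y|) * |w| + b y * powWeight p w)) μ :=
    (((integrable_finsetSum _ fun i _ => (hv i).abs.const_mul _).mul_const _).add
      (hb.mul_const _)).const_mul 2
  have hle : ∀ᵐ y ∂μ, |f x y w 0 - f x y 0 0 - deriv (fun t => f x y t 0) 0 * w|
      ≤ 2 * ((∑ i, |u i x| * |v i y|) * |w| + b y * powWeight p w) := by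
    filter_upwards [hd, h1] with y hd h1
    have i1 := increment_le hp hd (hb0 y) h1 (w := w) (z := 0) (by simpa using hM.le) hw
    have i2 := h1 0 0 (by simpa using hM.le) fun _ => by simpa using hM.le
    have i3 : derivWeight p 0 ≤ derivWeight p w := derivWeight_mono hp (by simp)
    have i4 : |deriv (fun t => f x y t 0) 0 * w|
        ≤ (∑ i, |u i x| * |v i y|) * |w| + b y * powWeight p w := by
      rw [abs_mul, ← abs_mul_derivWeight hp]
      refine (mul_le_mul_of_nonneg_right (i2.trans ?_) (abs_nonneg w)).trans_eq
        (b := (∑ i, |u i x| * |v i y| + b y * derivWeight p w) * |w|) (by ring)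
      gcongr
      exact hb0 y
    have := abs_sub (f x y w 0 - f x y 0 0) (deriv (fun t => f x y t 0) 0 * w)
    linarith
  have hsum : ∫ y, 2 * ((∑ i, |u i x| * |v i y|) * |w| + b y * powWeight p w) ∂μ
      = 2 * (∑ i, |u i x| * |w| * V i + (∫ y, b y ∂μ) * powWeight p w) := by
    rw [integral_const_mul, integral_add
      ((integrable_finsetSum _ fun i _ => (hv i).abs.const_mul _).mul_const _)
      (hb.mul_const _), integral_mul_const, integral_mul_const,
      integral_finsetSum _ fun i _ => (hv i).abs.const_mul _, Finset.sum_mul]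
    simp_rw [integral_const_mul]
    congr 2
    exact Finset.sum_congr rfl fun i _ => by simp only [V]; ring
  have hfinal : ∑ i, |u i x| * |w| * V i ≤ ∑ i, a i x * V i + (∑ i, C i * V i) * powWeight p w := by
    rw [Finset.sum_mul, ← Finset.sum_add_distrib]
    refine Finset.sum_le_sum fun i _ => ?_
    have := mul_le_mul_of_nonneg_right (hY i w hw) (hV i)
    linarith
  have hpw := powWeight_nonneg p w
  rw [pp_eq_ofReal_powWeight hw, ← ENNReal.ofReal_mul (by positivity)]
  calc _ ≤ 2 * ∫⁻ y, ENNReal.ofReal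
        (2 * ((∑ i, |u i x| * |v i y|) * |w| + b y * powWeight p w)) ∂μ := by
        gcongr 2 * ?_
        refine lintegral_mono_ae ?_
        filter_upwards [hle] with y hy using ENNReal.ofReal_le_ofReal hy
    _ = ENNReal.ofReal (2 * (2 * (∑ i, |u i x| * |w| * V i + (∫ y, b y ∂μ) * powWeight p w))) := by
        rw [← ofReal_integral_eq_lintegral_ofReal hint, hsum,
          ENNReal.ofReal_mul (p := 2) zero_le_two (q := 2 * _), ENNReal.ofReal_ofNat]
        refine Filter.Eventually.of_forall fun y => ?_
        have : 0 ≤ ∑ i, |u i x| * |v i y| := Finset.sum_nonneg fun i _ => by positivity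
        have := hb0 y
        simp only [Pi.zero_apply]
        positivity
    _ ≤ ENNReal.ofReal (4 * ∑ i, a i x * V i
          + (4 * (∑ i, C i * V i + ∫ y, b y ∂μ) + 1) * powWeight p w) :=
        ENNReal.ofReal_le_ofReal (by linarith)
    _ ≤ _ := ENNReal.ofReal_add_le

end IsRegular

/-! ### The two implications over a general measure space -/

namespace IsRegular

variable {p : ℝ≥0∞} {f : Ω → Ω → ℝ → ℝ → ℝ}

/-- After a modification on a null set, the integrand is smooth everywhere. -/
lemma exists_smooth_version (hf : IsRegular p μ f) : ∃ F F₁ F₂ : Ω → Ω → ℝ → ℝ → ℝ,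
    (Measurable fun q : Ω × Ω × ℝ × ℝ => F q.1 q.2.1 q.2.2.1 q.2.2.2) ∧
    (Measurable fun q : Ω × Ω × ℝ × ℝ => F₁ q.1 q.2.1 q.2.2.1 q.2.2.2) ∧
    (Measurable fun q : Ω × Ω × ℝ × ℝ => F₂ q.1 q.2.1 q.2.2.1 q.2.2.2) ∧
    (∀ x y w z, HasDerivAt (fun t => F x y t z) (F₁ x y w z) w) ∧
    (∀ x y w z, HasDerivAt (fun t => F₁ x y t z) (F₂ x y w z) w) ∧
    (∀ x y, Continuous fun q : ℝ × ℝ => F₂ x y q.1 q.2) ∧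
    ∀ᵐ s ∂μ.prod μ, ∀ w z, F s.1 s.2 w z = f s.1 s.2 w z ∧
      F₁ s.1 s.2 w z = deriv (fun t => f s.1 s.2 t z) w ∧
      F₂ s.1 s.2 w z = iteratedDeriv 2 (fun t => f s.1 s.2 t z) w := by
  classical
  -- The set of nonsmooth sections need not be measurable; setting `f` to zero on its measurable
  -- hull keeps joint measurability.
  let N : Set (Ω × Ω) := toMeasurable (μ.prod μ)
    {s | ¬ ContDiff ℝ 2 fun q : ℝ × ℝ => f s.1 s.2 q.1 q.2}
  have hN : MeasurableSet N := measurableSet_toMeasurable _ _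
  have hN0 : (μ.prod μ) N = 0 := by
    rw [measure_toMeasurable]
    exact hf.diff
  let F : Ω → Ω → ℝ → ℝ → ℝ := fun x y w z => if (x, y) ∈ N then 0 else f x y w z
  have hFN : ∀ x y, (x, y) ∉ N → F x y = f x y := fun x y h => by
    funext w z
    exact if_neg h
  have hFd : ∀ x y, ContDiff ℝ 2 fun q : ℝ × ℝ => F x y q.1 q.2 := by
    intro x y
    by_cases h : (x, y) ∈ N
    · simp only [F, if_pos h]
      exact contDiff_const
    · rw [hFN x y h]
      by_contra h'
      exact h (subset_toMeasurable _ _ h')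
  let F₁ : Ω → Ω → ℝ → ℝ → ℝ := fun x y w z => deriv (fun t => F x y t z) w
  let F₂ : Ω → Ω → ℝ → ℝ → ℝ := fun x y w z => deriv (fun t => F₁ x y t z) w
  have h1 := fun x y => contDiff_partial (n := 1) (hFd x y)
  have h2 := fun x y => contDiff_partial (n := 0) (G := F₁ x y) (by simpa using (h1 x y).1)
  have hFm : Measurable fun q : Ω × Ω × ℝ × ℝ => F q.1 q.2.1 q.2.2.1 q.2.2.2 :=
    Measurable.ite (hN.preimage (f := fun q : Ω × Ω × ℝ × ℝ => (q.1, q.2.1)) (by fun_prop))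
      measurable_const hf.meas
  have hF₁m := measurable_of_hasDerivAt_third hFm fun x y => (h1 x y).2
  have hF₂m := measurable_of_hasDerivAt_third (v := F₁) hF₁m fun x y => (h2 x y).2
  refine ⟨F, F₁, F₂, hFm, hF₁m, hF₂m, fun x y => (h1 x y).2, fun x y => (h2 x y).2,
    fun x y => (h2 x y).1.continuous, ?_⟩
  have hae : ∀ᵐ s ∂μ.prod μ, s ∉ N := measure_eq_zero_iff_ae_notMem.1 hN0
  filter_upwards [hae] with s hs w z
  have := hFN s.1 s.2 hs
  simp only [F₂, F₁, iteratedDeriv_two, this, true_and]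

lemma exists_null_of_convexOn [IsFiniteMeasure μ] [IsSeparable μ] [NeZero μ] (hp : 1 ≤ p)
    (hf : IsRegular p μ f)
    (hconv : ∀ ψ : Ω → ℝ, MemLp ψ p μ → ∀ᵐ x ∂μ, ConvexOn ℝ univ fun w => ∫ y, f x y w (ψ y) ∂μ) :
    ∃ g : Ω → Ω → ℝ → ℝ, (Measurable fun q : Ω × Ω × ℝ => g q.1 q.2.1 q.2.2) ∧
      (∀ M : ℝ, 0 < M → ∃ (a : Ω → ℝ) (C : ℝ), MemLp a 1 μ ∧ 0 < C ∧
        ∀ᵐ x ∂μ, ∀ w : ℝ, ∫⁻ y, ENNReal.ofReal |g x y w| ∂μ ≤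
          ENNReal.ofReal (a x) + ENNReal.ofReal C * pp p M w) ∧
      (∀ᵐ x ∂μ, ∀ w : ℝ, ∫ y, g x y w ∂μ = 0) ∧
      ∀ᵐ s ∂μ.prod μ, ∀ z, ConvexOn ℝ univ fun w => f s.1 s.2 w z - g s.1 s.2 w := by
  obtain ⟨F, F₁, F₂, hFm, hF₁m, hF₂m, hd₁, hd₂, hcont, hF⟩ := hf.exists_smooth_version
  choose A hA hAb using hf.exists_dominating hp
  have hFx := Measure.ae_ae_of_ae_prod hF
  have hdom : ∀ᵐ x ∂μ, DominatedFamily μ (F x) (F₁ x) (F₂ x) := by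
    have h1 : ∀ᵐ x ∂μ, ∀ n, Integrable (fun y => A n (x, y)) μ :=
      ae_all_iff.2 fun n => (hA n).prod_right_ae
    have h2 := ae_all_iff.2 fun n : ℕ => Measure.ae_ae_of_ae_prod (hAb n)
    filter_upwards [h1, h2, hFx] with x h1 h2 h3
    refine ⟨hFm.comp measurable_prodMk_left, hF₁m.comp measurable_prodMk_left,
      hF₂m.comp measurable_prodMk_left, hd₁ x, hd₂ x, hcont x, fun n => ⟨_, h1 n, ?_⟩⟩
    filter_upwards [h2 n, h3] with y h2 h3 w z hw hz
    obtain ⟨e0, e1, e2⟩ := h3 w z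
    rw [e0, e1, e2]
    exact h2 w z hw hz
  choose d hdm hdb hdense using exists_countable_dense_bounded μ
  have hpos : ∀ᵐ x ∂μ, ∀ (w : ℝ) (n : ℕ) (ψ : Ω → ℝ), Measurable ψ → (∀ y, |ψ y| ≤ n) →
      0 ≤ ∫ y, F₂ x y w (ψ y) ∂μ := by
    have h1 : ∀ᵐ x ∂μ, ∀ n i, ConvexOn ℝ univ fun w => ∫ y, f x y w (d n i y) ∂μ :=
      ae_all_iff.2 fun n => ae_all_iff.2 fun i => hconv _
        (MemLp.of_bound (hdm n i).aestronglyMeasurable (n : ℝ)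
          (Filter.Eventually.of_forall (hdb n i)))
    filter_upwards [hdom, h1, hFx] with x hx h1 h3 w n ψ hψ hψn
    obtain ⟨k, hk⟩ := hdense n ψ hψ hψn
    refine hx.integral_nonneg_of_dense (hdm n) (hdb n) hk fun i => ?_
    refine hx.integral_nonneg_of_convexOn (hdm n i) (hdb n i) ?_ w
    refine (h1 n i).congr fun w _ => integral_congr_ae ?_
    filter_upwards [h3] with y hy using (hy w _).1.symm
  refine ⟨fun x => nullPart μ (F x) (F₁ x) (F₂ x), measurable_nullPart hFm hF₁m hF₂m, ?_, ?_, ?_⟩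
  · intro M hM
    obtain ⟨a, C, ha, hC, hb⟩ := hf.remainder_growth hp hM
    refine ⟨a, C, memLp_one_iff_integrable.2 ha, hC, ?_⟩
    filter_upwards [hdom, hpos, hb, hFx] with x hx hp hb h3 w
    refine (hx.lintegral_nullPart_le hp w).trans (le_of_eq_of_le ?_ (hb w))
    congr 1
    refine lintegral_congr_ae ?_
    filter_upwards [h3] with y hy
    rw [(hy w 0).1, (hy 0 0).1, (hy 0 0).2.1]
  · filter_upwards [hdom, hpos] with x hx hp w using hx.integral_nullPart hp w
  · have hkm := measurable_convexPart (μ := μ) hF₂m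
    have hfin : ∀ᵐ s ∂μ.prod μ, ∀ n : ℕ, convexPart μ (F₂ s.1) s.2 n ≠ ∞ ∧
        convexPart μ (F₂ s.1) s.2 (-n) ≠ ∞ := by
      have hm : ∀ w : ℝ, Measurable fun s : Ω × Ω => convexPart μ (F₂ s.1) s.2 w := fun w =>
        hkm.comp (f := fun s : Ω × Ω => (s.1, s.2, w)) (by fun_prop)
      have h1 : ∀ w : ℝ, ∀ᵐ s ∂μ.prod μ, convexPart μ (F₂ s.1) s.2 w ≠ ∞ := fun w => by
        have hms : MeasurableSet {s : Ω × Ω | convexPart μ (F₂ s.1) s.2 w ≠ ∞} :=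
          (hm w) (measurableSet_singleton ∞).compl
        -- Joint measurability of `convexPart` is what allows passing from almost every `y` for
        -- almost every `x` to almost every pair.
        rw [Measure.ae_prod_iff_ae_ae hms]
        filter_upwards [hdom, hpos] with x hx hp
        filter_upwards [hx.ae_convexPart_ne_top hp] with y hy using hy w
      exact ae_all_iff.2 fun n => (h1 (n : ℝ)).and (h1 (-(n : ℝ)))
    have hdoms := Measure.quasiMeasurePreserving_fst (μ := μ) (ν := μ) |>.ae hdom
    filter_upwards [hdoms, hfin, hF] with s hs hfin hF z
    have := hs.convexOn_sub_nullPart (y := s.2) (DominatedFamily.convexPart_ne_top_of_natCast hfin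
      (hs.measurable_curvature_right s.2)) z
    refine this.congr fun w _ => ?_
    simp only [(hF w z).1]

/-- The growth bound on `g` makes `g(y,x,ψ(y))` integrable on the product: its integral over `x` is
at most `a(y) + C |ψ(y)|^p`, without the power if `p = ∞`. With `f`, `g` and `h` integrable in `y`,
so is `f'`, and the integral splits. -/
lemma convexOn_of_eq_add_null [IsFiniteMeasure μ] (hp : 1 ≤ p)
    (hf : IsRegular p μ f) {f' : Ω → Ω → ℝ → ℝ → ℝ} {g : Ω → Ω → ℝ → ℝ} {h : Ω → Ω → ℝ}
    (hg : Measurable fun q : Ω × Ω × ℝ => g q.1 q.2.1 q.2.2)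
    (hh : Integrable (fun s : Ω × Ω => h s.1 s.2) (μ.prod μ))
    (hgb : ∀ M : ℝ, 0 < M → ∃ (a : Ω → ℝ) (C : ℝ), MemLp a 1 μ ∧ 0 < C ∧
        ∀ᵐ x ∂μ, ∀ w : ℝ, ∫⁻ y, ENNReal.ofReal |g x y w| ∂μ ≤
          ENNReal.ofReal (a x) + ENNReal.ofReal C * pp p M w)
    (hg0 : ∀ᵐ x ∂μ, ∀ w : ℝ, ∫ y, g x y w ∂μ = 0)
    (hf' : ∀ᵐ s ∂μ.prod μ, ∀ z, ConvexOn ℝ univ fun w => f' s.1 s.2 w z)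
    (heq : ∀ᵐ s ∂μ.prod μ, ∀ w z, f s.1 s.2 w z
      = f' s.1 s.2 w z + (g s.1 s.2 w + g s.2 s.1 z + h s.1 s.2))
    {ψ : Ω → ℝ} (hψ : MemLp ψ p μ) :
    ∀ᵐ x ∂μ, ConvexOn ℝ univ fun w => ∫ y, f x y w (ψ y) ∂μ := by
  wlog hψm : Measurable ψ generalizing ψ
  · have hm : AEMeasurable ψ μ := hψ.1.aemeasurable
    have := this ((memLp_congr_ae hm.ae_eq_mk).1 hψ) hm.measurable_mk
    filter_upwards [this] with x hx
    refine hx.congr fun w _ => integral_congr_ae ?_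
    filter_upwards [hm.ae_eq_mk] with y hy
    rw [hy]
  have hgi : ∀ᵐ x ∂μ, ∀ w, Integrable (g x · w) μ := by
    have : ∀ᵐ x ∂μ, ∀ n : ℕ, ∀ w : ℝ, |w| ≤ n + 1 → ∫⁻ y, ENNReal.ofReal |g x y w| ∂μ < ∞ := by
      refine ae_all_iff.2 fun n => ?_
      obtain ⟨a, C, -, -, hb⟩ := hgb (n + 1) (by positivity)
      filter_upwards [hb] with x hx w hw
      refine (hx w).trans_lt ?_
      rw [pp_eq_ofReal_powWeight fun _ => hw, ← ENNReal.ofReal_mul' (powWeight_nonneg p w)]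
      exact ENNReal.add_lt_top.2 ⟨ENNReal.ofReal_lt_top, ENNReal.ofReal_lt_top⟩
    filter_upwards [this] with x hx w
    obtain ⟨n, hn⟩ := exists_nat_ge |w|
    refine ⟨(hg.comp (f := fun y => (x, y, w)) (by fun_prop)).aestronglyMeasurable, ?_⟩
    rw [hasFiniteIntegral_iff_norm]
    exact hx n w (by linarith)
  have hgψ : ∀ᵐ x ∂μ, Integrable (fun y => g y x (ψ y)) μ := by
    have hm : Measurable fun s : Ω × Ω => g s.1 s.2 (ψ s.1) :=
      hg.comp (f := fun s : Ω × Ω => (s.1, s.2, ψ s.1)) (by fun_prop)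
    have : Integrable (fun s : Ω × Ω => g s.1 s.2 (ψ s.1)) (μ.prod μ) := by
      refine ⟨hm.aestronglyMeasurable, ?_⟩
      rw [hasFiniteIntegral_iff_norm, lintegral_prod _ hm.norm.ennreal_ofReal.aemeasurable]
      obtain ⟨M, hM, hψM⟩ : ∃ M : ℝ, 0 < M ∧ ∀ᵐ y ∂μ, p = ∞ → |ψ y| ≤ M := by
        refine ⟨(eLpNormEssSup ψ μ).toReal + 1,
          add_pos_of_nonneg_of_pos ENNReal.toReal_nonneg one_pos, ?_⟩
        filter_upwards [ae_le_eLpNormEssSup (f := ψ) (μ := μ)] with y hy hpt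
        subst hpt
        have hfin : eLpNormEssSup ψ μ ≠ ∞ := by
          have := hψ.2
          rw [eLpNorm_exponent_top] at this
          exact this.ne
        have h2 := ENNReal.toReal_mono hfin hy
        rw [toReal_enorm, Real.norm_eq_abs] at h2
        linarith
      obtain ⟨a, C, ha, hC, hb⟩ := hgb M hM
      have hi := (memLp_one_iff_integrable.1 ha).abs.add
        ((integrable_powWeight_comp hp hψ).const_mul C)
      refine lt_of_le_of_lt (lintegral_mono_ae ?_) hi.lintegral_lt_top
      filter_upwards [hb, hψM] with y hy hyM
      refine (hy (ψ y)).trans ?_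
      rw [pp_eq_ofReal_powWeight hyM, ← ENNReal.ofReal_mul hC.le]
      simp only [Pi.add_apply]
      rw [ENNReal.ofReal_add (abs_nonneg _) (mul_nonneg hC.le (powWeight_nonneg _ _))]
      gcongr
      exact le_abs_self _
    exact this.prod_left_ae
  filter_upwards [hgi, hgψ, hh.prod_right_ae, hg0, Measure.ae_ae_of_ae_prod hf',
    Measure.ae_ae_of_ae_prod heq, hf.ae_integrable hp hψm hψ] with x h1 h2 h3 h4 h5 h6 h7
  have h8 : ∀ w, Integrable (fun y => f' x y w (ψ y)) μ := fun w => by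
    have := (h7 w).sub (((h1 w).add h2).add h3)
    refine this.congr ?_
    filter_upwards [h6] with y hy
    simp only [Pi.sub_apply, Pi.add_apply, hy]
    ring
  have h9 : ConvexOn ℝ univ fun w => ∫ y, f' x y w (ψ y) ∂μ :=
    convexOn_integral (F := fun w y => f' x y w (ψ y))
      (by filter_upwards [h5] with y hy using hy (ψ y)) h8
  refine (h9.add (convexOn_const (∫ y, g y x (ψ y) ∂μ + ∫ y, h x y ∂μ) convex_univ)).congr
    fun w _ => ?_
  have e : ∫ y, f x y w (ψ y) ∂μ
      = ∫ y, (f' x y w (ψ y) + (g x y w + (g y x (ψ y) + h x y))) ∂μ := by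
    refine integral_congr_ae ?_
    filter_upwards [h6] with y hy
    rw [hy]
    ring
  have h23 : Integrable (fun y => g y x (ψ y) + h x y) μ := h2.add h3
  have h123 : Integrable (fun y => g x y w + (g y x (ψ y) + h x y)) μ := (h1 w).add h23
  simp only [Pi.add_apply]
  rw [e, integral_add (h8 w) h123, integral_add (h1 w) h23, integral_add h2 h3, h4, zero_add]

end IsRegular

end Generic

/-! ### Bounded subsets of `ℝ^m` -/

lemma PRegular.isRegular {m : ℕ} {X : Set (LebesgueSpace m)} {p : ℝ≥0∞} (hp : 1 ≤ p)
    {f : X → X → ℝ → ℝ → ℝ} (hf : PRegular p f)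
    (hf2 : ∀ᵐ s : X × X, ContDiff ℝ 2 (fun q : ℝ × ℝ => f s.1 s.2 q.1 q.2))
    (hbound : ∀ M : ℝ, 0 < M → ∃ a : X → X → ℝ,
      Integrable (fun s : X × X => a s.1 s.2) volume ∧
      ∀ᵐ s : X × X, ∀ w z : ℝ, |w| ≤ M → |z| ≤ M →
        |iteratedDeriv 2 (fun t => f s.1 s.2 t z) w| ≤ a s.1 s.2) :
    IsRegular p volume f := by
  refine ⟨hf.symmetric, hf.measurable, hf.integrable_base, hf2, ?_, fun M hM => ?_⟩
  · intro M hM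
    obtain ⟨a, b, ha0, hb0, ⟨k, u, v, hu, hv, ha⟩, hb, hbd⟩ := hf.bound M hM
    refine ⟨k, u, v, b, hu, fun i => memLp_one_iff_integrable.1 (hv i),
      memLp_one_iff_integrable.1 hb, fun y => (hb0 y).le, ?_⟩
    have ha' : ∀ᵐ s ∂(volume : Measure X).prod volume, a s.1 s.2 = ∑ i, u i s.1 * v i s.2 := ha
    have hbd' : ∀ᵐ s ∂(volume : Measure X).prod volume, ∀ w z : ℝ, |z| ≤ M →
      ENNReal.ofReal |deriv (fun t => f s.1 s.2 t z) w| ≤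
        ENNReal.ofReal (a s.1 s.2) + ENNReal.ofReal (b s.2) * pp (p - 1) M w := hbd
    filter_upwards [ha', hbd'] with s h1 h2 w z hz hw
    have h3 := h2 w z hz
    have hW := derivWeight_nonneg p w
    rw [pp_sub_one hp hw, ← ENNReal.ofReal_mul (hb0 _).le,
      ← ENNReal.ofReal_add (ha0 _ _).le (mul_nonneg (hb0 _).le hW),
      ENNReal.ofReal_le_ofReal_iff
        (add_nonneg (ha0 _ _).le (mul_nonneg (hb0 _).le hW))] at h3
    refine h3.trans ?_
    gcongr
    rw [h1]
    refine Finset.sum_le_sum fun i _ => ?_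
    rw [← abs_mul]
    exact le_abs_self _
  · obtain ⟨a, ha, hb⟩ := hbound M hM
    exact ⟨fun s => a s.1 s.2, ha, hb⟩

end NonLocal

theorem mainTheorem2 {m : ℕ} (X : Set (NonLocal.LebesgueSpace m))
    (hX : MeasurableSet X) (hXb : NonLocal.IsBoundedSet X)
    (p : ℝ≥0∞) (hp : 1 ≤ p)
    (f : X → X → ℝ → ℝ → ℝ) (hf : NonLocal.PRegular p f)
    (hf2 : ∀ᵐ s : X × X, ContDiff ℝ 2 (fun q : ℝ × ℝ => f s.1 s.2 q.1 q.2))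
    (hbound : ∀ M : ℝ, 0 < M → ∃ a : X → X → ℝ,
      Integrable (fun s : X × X => a s.1 s.2) volume ∧
      ∀ᵐ s : X × X, ∀ w z : ℝ, |w| ≤ M → |z| ≤ M →
        |iteratedDeriv 2 (fun t => f s.1 s.2 t z) w| ≤ a s.1 s.2) :
    (∀ ψ : X → ℝ, MemLp ψ p volume →
      ∀ᵐ x : X, ConvexOn ℝ univ (NonLocal.Phi f x ψ)) ↔
    ∃ f' f₀ : X → X → ℝ → ℝ → ℝ,
      NonLocal.PairwiseSymmetric f' ∧ NonLocal.IntegrandMeasurable f' ∧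
      NonLocal.MemN0 p f₀ ∧
      (∀ᵐ s : X × X, NonLocal.SeparatelyConvex (f' s.1 s.2)) ∧
      ∀ᵐ s : X × X, ∀ w z : ℝ, f s.1 s.2 w z = f' s.1 s.2 w z + f₀ s.1 s.2 w z := by
  have : Fact (MeasurableSet X) := ⟨hX⟩
  have : IsFiniteMeasure (volume : Measure X) := NonLocal.isFiniteMeasure_volume_subtype hX hXb
  have hreg := hf.isRegular hp hf2 hbound
  constructor
  · intro hconv
    obtain ⟨g, hg, hgb, hg0, hgc⟩ : ∃ g : X → X → ℝ → ℝ,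
        (Measurable fun q : X × X × ℝ => g q.1 q.2.1 q.2.2) ∧
        (∀ M : ℝ, 0 < M → ∃ (a : X → ℝ) (C : ℝ), MemLp a 1 volume ∧ 0 < C ∧
          ∀ᵐ x : X, ∀ w : ℝ, ∫⁻ y : X, ENNReal.ofReal |g x y w| ≤
            ENNReal.ofReal (a x) + ENNReal.ofReal C * NonLocal.pp p M w) ∧
        (∀ᵐ x : X, ∀ w : ℝ, ∫ y : X, g x y w = 0) ∧
        ∀ᵐ s ∂(volume : Measure X).prod volume, ∀ z,
          ConvexOn ℝ univ fun w => f s.1 s.2 w z - g s.1 s.2 w := by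
      -- The mean over `y` requires positive total mass; on a null set `g = 0` works trivially.
      rcases eq_zero_or_neZero (volume : Measure X) with h0 | h0
      · refine ⟨fun _ _ _ => 0, measurable_const, fun M _ => ⟨fun _ => 0, 1, MemLp.zero',
          one_pos, ?_⟩, ?_, ?_⟩ <;> simp [h0]
      · exact hreg.exists_null_of_convexOn hp hconv
    have hg₀m : Measurable fun q : X × X × ℝ × ℝ => g q.1 q.2.1 q.2.2.1 + g q.2.1 q.1 q.2.2.2 :=
      (hg.comp (f := fun q : X × X × ℝ × ℝ => (q.1, q.2.1, q.2.2.1)) (by fun_prop)).add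
        (hg.comp (f := fun q : X × X × ℝ × ℝ => (q.2.1, q.1, q.2.2.2)) (by fun_prop))
    refine ⟨fun x y w z => f x y w z - (g x y w + g y x z), fun x y w z => g x y w + g y x z,
      fun x y w z => ?_, hf.measurable.sub hg₀m,
      ⟨fun x y w z => add_comm _ _, hg₀m, g, fun _ _ => 0, hg, integrable_zero _ _ _,
        fun _ _ => rfl, hgb, by simp, hg0, Filter.Eventually.of_forall fun s w z => by simp⟩,
      ?_, Filter.Eventually.of_forall fun s w z => (sub_add_cancel _ _).symm⟩
    · beta_reduce
      rw [hf.symmetric x y w z, add_comm]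
    · have hgc' := NonLocal.ae_swap hgc
      have key : ∀ᵐ s ∂(volume : Measure X).prod volume,
          NonLocal.SeparatelyConvex fun w z => f s.1 s.2 w z - (g s.1 s.2 w + g s.2 s.1 z) := by
        filter_upwards [hgc, hgc'] with s h1 h2
        refine ⟨fun z => ?_, fun z => ?_⟩
        · refine ((h1 z).add (convexOn_const (-g s.2 s.1 z) convex_univ)).congr fun w _ => ?_
          simp only [Pi.add_apply]
          ring
        · refine ((h2 z).add (convexOn_const (-g s.1 s.2 z) convex_univ)).congr fun w _ => ?_
          simp only [Pi.add_apply, Prod.fst_swap, Prod.snd_swap, hf.symmetric s.2 s.1 w z]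
          ring
      exact key
  · rintro ⟨f', f₀, -, -, ⟨-, -, g, h, hg, hh, -, hgb, -, hg0, hf₀⟩, hsep, heq⟩ ψ hψ
    have hsep' : ∀ᵐ s ∂(volume : Measure X).prod volume,
        NonLocal.SeparatelyConvex (f' s.1 s.2) := hsep
    have heq' : ∀ᵐ s ∂(volume : Measure X).prod volume, ∀ w z : ℝ,
        f s.1 s.2 w z = f' s.1 s.2 w z + f₀ s.1 s.2 w z := heq
    have hf₀' : ∀ᵐ s ∂(volume : Measure X).prod volume, ∀ w z : ℝ,
        f₀ s.1 s.2 w z = g s.1 s.2 w + g s.2 s.1 z + h s.1 s.2 := hf₀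
    refine hreg.convexOn_of_eq_add_null hp (f' := f') hg hh hgb hg0 ?_ ?_ hψ
    · filter_upwards [hsep'] with s hs using hs.1
    · filter_upwards [heq', hf₀'] with s h1 h2 w z
      rw [h1, h2]
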